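/- Write $\mathbb Z^+=\{0,1,2,\dots\}$ and $\mathbb N=\{1,2,\dots\}$. A probability on $\mathbb Z^+$ is a function $F\colon\mathbb Z^+\to[0,1]$ with $\sum_{k\ge 0}F(k)=1$; $F^{(n)}$ denotes its $n$-th convolution power, and $\mathcal A$ is the class of all probabilities $F$ on $\mathbb Z^+$ with $$\sup_{n\in\mathbb N} n\sum_{k\ge 0}\bigl|F^{(n)}(k)-F^{(n+1)}(k)\bigr|<\infty .$$ A bounded linear operator $S$ on a complex Banach space is power-bounded if $\sup_{n\in\mathbb N}\|S^n\|<\infty$, and it is a Ritt operator if it is power-bounded and $\sup_{n\in\mathbb N}n\|S^n-S^{n+1}\|<\infty$. Theorem. Let $\alpha\in(0,1)$, and put $A_\alpha(0)=0$ and $$A_\alpha(k)=\frac{\alpha(1-\alpha)(2-\alpha)\cdots((k-1)-\alpha)}{k!}\qquad(k\in\mathbb N).$$ Then $A_\alpha$ is a probability on $\mathbb Z^+$; its generating function is $$\sum_{k\ge 0}A_\alpha(k)w^k=1-(1-w)^\alpha\qquad(w\in\mathbb C,\ |w|\le 1),$$ with the principal branch of the power; and $A_\alpha\in\mathcal A$.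 Moreover, for every complex Banach space $X$ and every power-bounded operator $T$ on $X$, the series $\Psi(A_\alpha;T)=\sum_{k\ge 0}A_\alpha(k)T^k$ converges absolutely in operator norm, one has $$\Psi(A_\alpha;T)=I-(I-T)^\alpha ,$$ and this operator is a Ritt operator. Here the operator $V=I-T$ is nonnegative, that is, $tI+V$ is invertible for all $t>0$ and $\sup_{t>0}\|t(tI+V)^{-1}\|<\infty$, and its fractional power is given by the Balakrishnan formula $$V^\alpha=\frac{\sin(\pi\alpha)}{\pi}\int_0^\infty t^{\alpha-1}(tI+V)^{-1}V\,dt,$$ where the integral converges absolutely in operator norm. -/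

import Mathlib

namespace RittSubordination

/-- A probability on the nonnegative integers: a function with values in the unit interval
whose sum is one. -/
def IsProbability (F : ℕ → ℝ) : Prop :=
  (∀ k, F k ∈ Set.Icc (0 : ℝ) 1) ∧ HasSum F 1

/-- The convolution product of two functions on the nonnegative integers. -/
def conv (F G : ℕ → ℝ) (m : ℕ) : ℝ :=
  ∑ p ∈ Finset.HasAntidiagonal.antidiagonal m, F p.1 * G p.2

/-- The convolution powers of `F`; the zeroth one is the unit mass at `0`. -/
def convPow (F : ℕ → ℝ) : ℕ → ℕ → ℝ
  | 0 => fun k => if k = 0 then 1 else 0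
  | n + 1 => conv F (convPow F n)

/-- The class of Ritt probabilities: the probabilities `F` such that `n` times the `ℓ¹` distance
of the `n`-th and the `(n+1)`-st convolution power of `F` is bounded over `n ≥ 1`. -/
def classA : Set (ℕ → ℝ) :=
  {F | IsProbability F ∧
    ∃ C : ℝ, ∀ n : ℕ, 1 ≤ n →
      Summable (fun k => |convPow F n k - convPow F (n + 1) k|) ∧
      (n : ℝ) * ∑' k, |convPow F n k - convPow F (n + 1) k| ≤ C}

/-- The function `A_α`, with `A_α(0) = 0` and `A_α(k) = α (1-α) (2-α) ⋯ ((k-1)-α) / k!` for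
`k ≥ 1`. -/
noncomputable def A (α : ℝ) (k : ℕ) : ℝ :=
  if k = 0 then 0
  else (α * ∏ j ∈ Finset.Ico 1 k, ((j : ℝ) - α)) / (Nat.factorial k : ℝ)

section Operators

variable {X : Type*} [NormedAddCommGroup X] [NormedSpace ℂ X]

/-- `T` is power-bounded: the norms of its powers are bounded. -/
def IsPowerBounded (T : X →L[ℂ] X) : Prop :=
  ∃ C : ℝ, ∀ n : ℕ, 1 ≤ n → ‖T ^ n‖ ≤ C

/-- `S` is a Ritt operator. -/
def IsRitt (S : X →L[ℂ] X) : Prop :=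
  IsPowerBounded S ∧ ∃ C : ℝ, ∀ n : ℕ, 1 ≤ n → (n : ℝ) * ‖S ^ n - S ^ (n + 1)‖ ≤ C

/-- The subordinated operator `Ψ(F; T) = ∑ F(k) T^k`, a series in operator norm. -/
noncomputable def Psi (F : ℕ → ℝ) (T : X →L[ℂ] X) : X →L[ℂ] X :=
  ∑' k, (F k : ℂ) • T ^ k

/-- `V` is a nonnegative operator: `t + V` is invertible for each `t > 0`, and the norm of
`t (t + V)⁻¹` is bounded over `t > 0`. These are the bounded operators for which
fractional powers are defined. -/
def IsNonnegativeOperator (V : X →L[ℂ] X) : Prop :=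
  (∀ t : ℝ, 0 < t → IsUnit ((t : ℂ) • (1 : X →L[ℂ] X) + V)) ∧
    ∃ M : ℝ, ∀ t : ℝ, 0 < t → t * ‖Ring.inverse ((t : ℂ) • (1 : X →L[ℂ] X) + V)‖ ≤ M

/-- The integrand `t^(α-1) (t + V)⁻¹ V` of the Balakrishnan formula. -/
noncomputable def balakrishnanIntegrand (V : X →L[ℂ] X) (α t : ℝ) : X →L[ℂ] X :=
  ((t ^ (α - 1) : ℝ) : ℂ) • (Ring.inverse ((t : ℂ) • (1 : X →L[ℂ] X) + V) * V)

/-- The fractional power `V^α`, for `0 < α < 1`, of a bounded nonnegative operator `V`,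
given by the Balakrishnan formula
`V^α = (sin (π α) / π) ∫_0^∞ t^(α-1) (t + V)⁻¹ V dt`
(a Bochner integral in operator norm). -/
noncomputable def fracPow (V : X →L[ℂ] X) (α : ℝ) : X →L[ℂ] X :=
  ((Real.sin (Real.pi * α) / Real.pi : ℝ) : ℂ) •
    ∫ t in Set.Ioi (0 : ℝ), balakrishnanIntegrand V α t

end Operators

end RittSubordination

namespace RittSubordination

open Filter Topology MeasureTheory

/-! The numbers `A α k` are, up to sign, the binomial coefficients of `α`, so the binomial series
gives the generating function inside the disc. Positivity of the coefficients and continuity carry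
it to the closed disc, and `w = 1` gives total mass one.

Operator side: for power-bounded `T` the resolvent `(t + 1 - T)⁻¹` is the series of `(1 + t)^(-k-1)
T^k`. In the Balakrishnan integrand the coefficient of `T^k` has constant sign in `t`, and its
integral is a Beta integral that reproduces `A α k`; this justifies exchanging sum and integral
(`Psi_A_eq`). Moreover `Psi F T ^ n` is the series with coefficients `F^(n)`, so ℓ¹ estimates on
convolution powers become norm estimates (`isRitt_Psi`). It remains to prove that `A α` lies in
`classA`.

Since `1 - (1 - w)^(βγ)` is the composition of `1 - (1 - z)^β` with `1 - (1 - w)^γ`, the convolution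
powers of `A (β * γ)` are mixtures of those of `A γ` with weights those of `A β`. Mixing contracts
ℓ¹, so membership passes from `β` to `βγ` (`A_mul_mem_classA`), and an exponent `β > 1/2` suffices.

For such `β` put `ζ = (1 - w)^β`. The differences `d k` of consecutive convolution powers have
generating function `(1 - ζ)^n ζ`, and `‖1 - ζ‖ ≤ exp(-c‖ζ‖)` on the disc
(`norm_one_sub_cpow_le_exp`). Parseval for this function and its derivative yields `∑ (L² + k²)
d(k)² ≤ D n^(1/β - 2)` with `L = n^(1/β)`, the natural scale of the `n`-th power. By Cauchy–Schwarz
the ℓ¹ norm of `d` is `O(1/n)`. The derivative has size `‖1 - w‖^(β - 1)` near `w = 1`, which is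
square integrable exactly because `β > 1/2`. -/

/-! ### Coefficients and generating function of `A α`. -/

lemma A_zero (α : ℝ) : A α 0 = 0 := by simp [A]

lemma A_succ_succ (α : ℝ) (k : ℕ) :
    A α (k + 2) = A α (k + 1) * ((k + 1 - α) / (k + 2)) := by
  have h : ((k + 1).factorial : ℝ) ≠ 0 := by positivity
  have h2 : ((k : ℝ) + 2) ≠ 0 := by positivity
  simp only [A, Nat.add_eq_zero_iff, one_ne_zero, and_false, if_false, OfNat.ofNat_ne_zero]
  rw [Finset.prod_Ico_succ_top (by omega), Nat.factorial_succ (k + 1)]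
  push_cast
  field_simp
  ring

lemma A_nonneg {α : ℝ} (hα : α ∈ Set.Ioo (0 : ℝ) 1) (k : ℕ) : 0 ≤ A α k := by
  unfold A
  split_ifs
  · exact le_rfl
  · refine div_nonneg (mul_nonneg hα.1.le (Finset.prod_nonneg fun j hj => ?_)) (by positivity)
    have : (1 : ℝ) ≤ j := by exact_mod_cast (Finset.mem_Ico.mp hj).1
    linarith [hα.2]

lemma choose_eq_A (α : ℝ) (k : ℕ) :
    Ring.choose α (k + 1) = (-1) ^ k * A α (k + 1) := by
  induction k with
  | zero => simp [A]
  | succ k ih =>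
    have h := Ring.choose_eq_smul (a := α) (n := k + 1)
    have h2 := Ring.choose_eq_smul (a := α) (n := k + 1 + 1)
    have hk : ((k : ℝ) + 2) ≠ 0 := by positivity
    have hk1 : ((k : ℝ) + 1) ≠ 0 := by positivity
    have hf : (k.factorial : ℝ) ≠ 0 := by positivity
    rw [A_succ_succ, pow_succ, mul_right_comm, ← mul_assoc, ← ih, h, h2, descPochhammer_succ_right]
    simp only [Polynomial.smeval_mul, Polynomial.smeval_sub, Polynomial.smeval_X, pow_one,
      Polynomial.smeval_natCast, pow_zero, nsmul_eq_mul, mul_one, smul_eq_mul, Nat.factorial_succ]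
    push_cast
    field_simp
    ring

lemma hasSum_A_mul_pow_of_lt (α : ℝ) {w : ℂ} (hw : ‖w‖ < 1) :
    HasSum (fun k : ℕ => (A α k : ℂ) * w ^ k) (1 - (1 - w) ^ (α : ℂ)) := by
  have h := (Complex.one_add_cpow_hasFPowerSeriesOnBall_zero (a := (α : ℂ))).hasSum (y := -w)
    (by simpa [enorm_eq_nnnorm, ← NNReal.coe_lt_coe] using hw)
  simp only [binomialSeries_apply, List.ofFn_const, List.prod_replicate,
    ← sub_eq_add_neg, smul_eq_mul] at h
  have h1 : HasSum (fun k : ℕ => if k = 0 then (1 : ℂ) else 0) 1 := by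
    simpa using hasSum_ite_eq (0 : ℕ) (1 : ℂ)
  rw [zero_sub, ← sub_eq_add_neg] at h
  refine (congrArg (HasSum · _) (funext fun k => ?_)).mp (h1.sub h)
  rcases k with _ | k
  · simp [A_zero]
  · rw [← Complex.ofReal_choose, choose_eq_A, neg_pow w (k + 1), pow_succ (-1 : ℂ) k]
    have h2 : ((-1 : ℂ) ^ k) * (-1) ^ k = 1 := by rw [← mul_pow]; simp
    push_cast
    linear_combination ((A α (k + 1) : ℂ) * w ^ (k + 1)) * h2

/-- On the closed disc `1 - w` has positive real part except at `w = 1`, where the positive exponent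
restores continuity. -/
lemma cpow_continuousOn {α : ℝ} (hα : 0 < α) :
    ContinuousOn (fun w : ℂ => (1 - w) ^ (α : ℂ)) (Metric.closedBall 0 1) := by
  intro w hw
  have hw : ‖w‖ ≤ 1 := by simpa using hw
  refine ContinuousAt.continuousWithinAt ?_
  refine ContinuousAt.comp (g := fun z : ℂ => z ^ (α : ℂ)) (f := fun w : ℂ => 1 - w) ?_ (by fun_prop)
  by_cases h : w = 1
  · subst h
    simpa using Complex.continuousAt_cpow_const_of_re_pos (z := 0) (w := α) (by simp) (by simpa)
  · refine continuousAt_cpow_const ?_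
    left
    have h1 : w.re ≤ 1 := (Complex.re_le_norm w).trans hw
    rcases h1.lt_or_eq with h1 | h1
    · simpa using h1
    · exfalso
      apply h
      have h2 : ‖w‖ ^ 2 ≤ 1 := by nlinarith [norm_nonneg w]
      rw [← Complex.normSq_eq_norm_sq, Complex.normSq_apply, h1] at h2
      exact Complex.ext (by simpa using h1) (by simpa using (by nlinarith : w.im = 0))

/-- For `0 < r < 1`, positivity bounds each partial sum at `r` by `1 - (1 - r)^α ≤ 1`; then `r → 1`.
-/
lemma summable_A {α : ℝ} (hα : α ∈ Set.Ioo (0 : ℝ) 1) : Summable (A α) := by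
  refine summable_of_sum_range_le (c := 1) (A_nonneg hα) fun n => ?_
  have h1 : Tendsto (fun r : ℝ => ∑ k ∈ Finset.range n, A α k * r ^ k) (𝓝[<] 1)
      (𝓝 (∑ k ∈ Finset.range n, A α k * 1 ^ k)) :=
    (Continuous.tendsto (by fun_prop) 1).mono_left nhdsWithin_le_nhds
  simp only [one_pow, mul_one] at h1
  refine le_of_tendsto h1 ?_
  filter_upwards [Ioo_mem_nhdsLT (zero_lt_one (α := ℝ))] with r hr
  have h2 := hasSum_A_mul_pow_of_lt α (w := (r : ℂ)) (by simpa [abs_of_pos hr.1] using hr.2)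
  have h3 : HasSum (fun k => A α k * r ^ k) (1 - (1 - r) ^ α) := by
    rw [← Complex.hasSum_ofReal]
    convert h2 using 1
    · ext; simp
    · rw [Complex.ofReal_sub, Complex.ofReal_cpow (by linarith [hr.2])]; simp
  have h4 := sum_le_hasSum (Finset.range n)
    (fun k _ => mul_nonneg (A_nonneg hα k) (pow_nonneg hr.1.le k)) h3
  have h5 : 0 ≤ (1 - r) ^ α := Real.rpow_nonneg (by linarith [hr.2]) _
  linarith

/-- Both sides are continuous on the closed disc and agree on the dense open disc. -/
lemma hasSum_A_mul_pow {α : ℝ} (hα : α ∈ Set.Ioo (0 : ℝ) 1) {w : ℂ} (hw : ‖w‖ ≤ 1) :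
    HasSum (fun k : ℕ => (A α k : ℂ) * w ^ k) (1 - (1 - w) ^ (α : ℂ)) := by
  have hb : ∀ (k : ℕ) (x : ℂ), x ∈ Metric.closedBall (0 : ℂ) 1 → ‖(A α k : ℂ) * x ^ k‖ ≤ A α k := by
    intro k x hx
    rw [norm_mul, norm_pow, Complex.norm_real, Real.norm_of_nonneg (A_nonneg hα k)]
    exact mul_le_of_le_one_right (A_nonneg hα k)
      (pow_le_one₀ (norm_nonneg x) (by simpa using hx))
  have hw' : w ∈ Metric.closedBall (0 : ℂ) 1 := by simpa using hw
  have h1 : ContinuousOn (fun x : ℂ => ∑' k, (A α k : ℂ) * x ^ k) (Metric.closedBall 0 1) :=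
    continuousOn_tsum (fun k => by fun_prop) (summable_A hα) hb
  have h2 : ContinuousOn (fun x : ℂ => 1 - (1 - x) ^ (α : ℂ)) (Metric.closedBall 0 1) :=
    continuousOn_const.sub (cpow_continuousOn hα.1)
  have h3 : Set.EqOn (fun x : ℂ => ∑' k, (A α k : ℂ) * x ^ k) (fun x : ℂ => 1 - (1 - x) ^ (α : ℂ))
      (Metric.ball 0 1) :=
    fun x hx => (hasSum_A_mul_pow_of_lt α (by simpa using hx)).tsum_eq
  have h4 := h3.of_subset_closure h1 h2 Metric.ball_subset_closedBall
    (closure_ball (0 : ℂ) one_ne_zero).ge hw'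
  simp only at h4
  rw [← h4]
  exact (Summable.of_norm_bounded (summable_A hα) fun k => hb k w hw').hasSum

lemma isProbability_A {α : ℝ} (hα : α ∈ Set.Ioo (0 : ℝ) 1) : IsProbability (A α) := by
  have h : HasSum (A α) 1 := by
    have h1 := hasSum_A_mul_pow hα (w := 1) (by simp)
    rw [← Complex.hasSum_ofReal]
    simpa [Complex.zero_cpow (Complex.ofReal_ne_zero.mpr hα.1.ne')] using h1
  exact ⟨fun k => ⟨A_nonneg hα k, le_hasSum h k fun j _ => A_nonneg hα j⟩, h⟩

/-! ### Convolution powers and the functional calculus. -/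

lemma IsProbability.conv {F G : ℕ → ℝ} (hF : IsProbability F) (hG : IsProbability G) :
    IsProbability (conv F G) := by
  have hF' : Summable fun k => ‖F k‖ := hF.2.summable.norm
  have hG' : Summable fun k => ‖G k‖ := hG.2.summable.norm
  have h0 : ∀ k, 0 ≤ RittSubordination.conv F G k := fun k =>
    Finset.sum_nonneg fun p _ => mul_nonneg (hF.1 _).1 (hG.1 _).1
  have h : HasSum (RittSubordination.conv F G) 1 := by
    have h1 := tsum_mul_tsum_eq_tsum_sum_antidiagonal_of_summable_norm hF' hG'
    have h2 := (summable_norm_sum_mul_antidiagonal_of_summable_norm hF' hG').of_norm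
    rw [hF.2.tsum_eq, hG.2.tsum_eq, one_mul] at h1
    rw [h1]
    exact h2.hasSum
  exact ⟨fun k => ⟨h0 k, le_hasSum h k fun j _ => h0 j⟩, h⟩

lemma IsProbability.convPow {F : ℕ → ℝ} (hF : IsProbability F) (n : ℕ) :
    IsProbability (convPow F n) := by
  induction n with
  | zero =>
    refine ⟨fun k => ?_, hasSum_ite_eq (0 : ℕ) (1 : ℝ)⟩
    simp only [RittSubordination.convPow]
    split_ifs <;> simp
  | succ n ih => exact hF.conv ih

section Algebra

variable {𝔸 : Type*} [NormedRing 𝔸] [NormedAlgebra ℂ 𝔸] {x : 𝔸} {M : ℝ}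

lemma norm_smul_pow_le (hM : ∀ k, ‖x ^ k‖ ≤ M) (a : ℝ) (k : ℕ) :
    ‖(a : ℂ) • x ^ k‖ ≤ |a| * M := by
  rw [norm_smul, Complex.norm_real, Real.norm_eq_abs]
  exact mul_le_mul_of_nonneg_left (hM k) (abs_nonneg a)

lemma summable_norm_smul_pow (hM : ∀ k, ‖x ^ k‖ ≤ M) {F : ℕ → ℝ} (hF : Summable F) :
    Summable fun k => ‖(F k : ℂ) • x ^ k‖ :=
  Summable.of_nonneg_of_le (fun _ => norm_nonneg _) (fun k => norm_smul_pow_le hM (F k) k)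
    (hF.abs.mul_right M)

/-- Cauchy products turn convolution into multiplication. Used both for operators and for complex
numbers of the closed disc. -/
lemma hasSum_convPow_smul_pow [CompleteSpace 𝔸] (hM : ∀ k, ‖x ^ k‖ ≤ M) {F : ℕ → ℝ}
    (hF : IsProbability F) (n : ℕ) :
    HasSum (fun k => (convPow F n k : ℂ) • x ^ k) ((∑' k, (F k : ℂ) • x ^ k) ^ n) := by
  induction n with
  | zero =>
    rw [pow_zero]
    refine (congrArg (HasSum · _) (funext fun k => ?_)).mp (hasSum_ite_eq (0 : ℕ) (1 : 𝔸))
    by_cases h : k = 0 <;> simp [convPow, h]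
  | succ n ih =>
    have h1 := summable_norm_smul_pow hM hF.2.summable
    have h2 := summable_norm_smul_pow hM (hF.convPow n).2.summable
    have h3 := tsum_mul_tsum_eq_tsum_sum_antidiagonal_of_summable_norm h1 h2
    have h4 := (summable_norm_sum_mul_antidiagonal_of_summable_norm h1 h2).of_norm
    rw [ih.tsum_eq, ← pow_succ'] at h3
    rw [h3]
    refine (congrArg (HasSum · _) (funext fun k => ?_)).mp h4.hasSum
    simp only [convPow, conv, Complex.ofReal_sum, Finset.sum_smul]
    refine Finset.sum_congr rfl fun p hp => ?_
    rw [smul_mul_smul_comm, ← pow_add, Finset.HasAntidiagonal.mem_antidiagonal.mp hp, Complex.ofReal_mul]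

end Algebra

/-! ### Beta integrals and the Balakrishnan coefficients. -/

/-- The substitution `t = x / (1 - x)` leads back to the Beta integral over the unit interval. -/
lemma integral_rpow_mul_one_add_rpow {a b : ℝ} (ha : 0 < a) (hb : 0 < b) :
    IntegrableOn (fun t : ℝ => t ^ (a - 1) * (1 + t) ^ (-(a + b))) (Set.Ioi 0) ∧
      ∫ t in Set.Ioi (0 : ℝ), t ^ (a - 1) * (1 + t) ^ (-(a + b)) = ProbabilityTheory.beta a b := by
  set f : ℝ → ℝ := fun x => x / (1 - x)
  set f' : ℝ → ℝ := fun x => 1 / (1 - x) ^ 2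
  have hf' : ∀ x ∈ Set.Ioo (0 : ℝ) 1, HasDerivWithinAt f (f' x) (Set.Ioo 0 1) x := by
    intro x hx
    have hx1 : 1 - x ≠ 0 := by linarith [hx.2]
    have h := ((hasDerivAt_id x).div ((hasDerivAt_const x (1 : ℝ)).sub (hasDerivAt_id x)) hx1)
    refine (h.congr_deriv ?_).hasDerivWithinAt
    simp [f']
  have hinj : Set.InjOn f (Set.Ioo 0 1) := by
    intro x hx y hy hxy
    have hx1 : 1 - x ≠ 0 := by linarith [hx.2]
    have hy1 : 1 - y ≠ 0 := by linarith [hy.2]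
    simp only [f, div_eq_div_iff hx1 hy1] at hxy
    linarith
  have himg : f '' Set.Ioo 0 1 = Set.Ioi 0 := by
    ext t
    constructor
    · rintro ⟨x, hx, rfl⟩
      exact div_pos hx.1 (by linarith [hx.2])
    · intro ht
      have ht : 0 < t := ht
      refine ⟨t / (1 + t), ⟨by positivity, by rw [div_lt_one (by positivity)]; linarith⟩, ?_⟩
      have : 1 + t ≠ 0 := by positivity
      simp only [f]
      field_simp
      simp
  have hg : ∀ x ∈ Set.Ioo (0 : ℝ) 1,
      |f' x| • (f x ^ (a - 1) * (1 + f x) ^ (-(a + b))) = x ^ (a - 1) * (1 - x) ^ (b - 1) := by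
    intro x hx
    have hx1 : 0 < 1 - x := by linarith [hx.2]
    have h1 : 1 + f x = (1 - x)⁻¹ := by simp only [f]; field_simp; ring
    have h2 : f' x = (1 - x) ^ (-2 : ℝ) := by
      simp only [f', Real.rpow_neg hx1.le]
      norm_cast
      simp
    rw [h1, h2, abs_of_pos (by positivity), Real.div_rpow hx.1.le hx1.le,
      Real.inv_rpow hx1.le, Real.rpow_neg hx1.le (a + b), inv_inv, smul_eq_mul, div_eq_mul_inv,
      ← Real.rpow_neg hx1.le (a - 1)]
    rw [show (1 - x) ^ (b - 1) = (1 - x) ^ (-2 : ℝ) * (1 - x) ^ (-(a - 1)) * (1 - x) ^ (a + b) by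
      rw [← Real.rpow_add hx1, ← Real.rpow_add hx1]; congr 1; ring]
    ring
  have hcast : ∀ x ∈ Set.Ioo (0 : ℝ) 1, (x : ℂ) ^ ((a : ℂ) - 1) * (1 - (x : ℂ)) ^ ((b : ℂ) - 1) =
      ((x ^ (a - 1) * (1 - x) ^ (b - 1) : ℝ) : ℂ) := by
    intro x hx
    rw [Complex.ofReal_mul, Complex.ofReal_cpow hx.1.le, Complex.ofReal_cpow (by linarith [hx.2])]
    push_cast
    rfl
  have hint : IntegrableOn (fun x : ℝ => x ^ (a - 1) * (1 - x) ^ (b - 1)) (Set.Ioo 0 1) := by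
    have h := Complex.betaIntegral_convergent (u := a) (v := b) (by simpa) (by simpa)
    rw [intervalIntegrable_iff_integrableOn_Ioo_of_le zero_le_one,
      integrableOn_congr_fun hcast measurableSet_Ioo] at h
    exact h.re
  constructor
  · rw [← himg, integrableOn_image_iff_integrableOn_abs_deriv_smul measurableSet_Ioo hf' hinj,
      integrableOn_congr_fun hg measurableSet_Ioo]
    exact hint
  · rw [← himg, integral_image_eq_integral_abs_deriv_smul measurableSet_Ioo hf' hinj,
      setIntegral_congr_fun measurableSet_Ioo hg, ProbabilityTheory.beta_eq_betaIntegralReal a b ha hb,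
      Complex.betaIntegral, intervalIntegral.integral_of_le zero_le_one, ← integral_Ioc_eq_integral_Ioo,
      integral_Ioc_eq_integral_Ioo, integral_Ioc_eq_integral_Ioo,
      setIntegral_congr_fun measurableSet_Ioo hcast, integral_complex_ofReal, Complex.ofReal_re]

/-- The coefficient of `T ^ k` in the expansion of `t ^ (α - 1) (t + 1 - T)⁻¹ (1 - T)`. -/
noncomputable def balakrishnanCoeff (α : ℝ) (k : ℕ) (t : ℝ) : ℝ :=
  t ^ (α - 1) * ((if k = 0 then 1 else 0) - t * ((1 + t) ^ (k + 1))⁻¹)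

lemma sin_pi_mul_pos {α : ℝ} (hα : α ∈ Set.Ioo (0 : ℝ) 1) : 0 < Real.sin (Real.pi * α) :=
  Real.sin_pos_of_pos_of_lt_pi (mul_pos Real.pi_pos hα.1)
    (by nlinarith [Real.pi_pos, hα.2])

lemma beta_eq_A {α : ℝ} (hα : α ∈ Set.Ioo (0 : ℝ) 1) (k : ℕ) :
    ProbabilityTheory.beta (α + 1) (k + 1 - α) =
      Real.pi / Real.sin (Real.pi * α) * A α (k + 1) := by
  have h1 := (sin_pi_mul_pos hα).ne'
  have h2 : Real.Gamma (1 - α) * Real.Gamma α = Real.pi / Real.sin (Real.pi * α) := by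
    rw [mul_comm, Real.Gamma_mul_Gamma_one_sub]
  induction k with
  | zero =>
    simp only [ProbabilityTheory.beta, Real.Gamma_add_one hα.1.ne', CharP.cast_eq_zero, zero_add,
      ← h2, A]
    rw [show α + 1 + (1 - α) = 2 by ring, Real.Gamma_two]
    simp
    ring
  | succ k ih =>
    have hk : (0 : ℝ) < k + 1 - α := by linarith [hα.2, (Nat.cast_nonneg k : (0 : ℝ) ≤ k)]
    have hk2 : (0 : ℝ) < k + 1 + 1 := by positivity
    have h3 : Real.Gamma (k + 1 + 1) ≠ 0 := (Real.Gamma_pos_of_pos hk2).ne'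
    rw [A_succ_succ, ← mul_assoc, ← ih]
    simp only [ProbabilityTheory.beta]
    rw [show ((k + 1 : ℕ) : ℝ) + 1 - α = (k + 1 - α) + 1 by push_cast; ring,
      Real.Gamma_add_one hk.ne',
      show α + 1 + ((k : ℝ) + 1 - α + 1) = (k + 1 + 1) + 1 by ring,
      show α + 1 + ((k : ℝ) + 1 - α) = k + 1 + 1 by ring,
      Real.Gamma_add_one hk2.ne']
    have : (k : ℝ) + 2 ≠ 0 := by positivity
    rw [show (k : ℝ) + 1 + 1 = k + 2 by ring] at *
    field_simp

/-- The coefficient equals `t^(α-1) / (1 + t)` for `k = 0` and `-t^α (1 + t)^(-k-1)` for `k ≥ 1`.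
The constant sign makes the integral of the absolute value the absolute value of the integral. -/
lemma integral_balakrishnanCoeff {α : ℝ} (hα : α ∈ Set.Ioo (0 : ℝ) 1) (k : ℕ) :
    IntegrableOn (balakrishnanCoeff α k) (Set.Ioi 0) ∧
      ∫ t in Set.Ioi (0 : ℝ), balakrishnanCoeff α k t =
        Real.pi / Real.sin (Real.pi * α) * ((if k = 0 then 1 else 0) - A α k) ∧
      ∫ t in Set.Ioi (0 : ℝ), |balakrishnanCoeff α k t| =
        |Real.pi / Real.sin (Real.pi * α) * ((if k = 0 then 1 else 0) - A α k)| := by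
  have hs := sin_pi_mul_pos hα
  rcases k with _ | k
  · have hc : ∀ t ∈ Set.Ioi (0 : ℝ), balakrishnanCoeff α 0 t =
        t ^ (α - 1) * (1 + t) ^ (-(α + (1 - α))) := by
      intro t ht
      have ht : 0 < t := ht
      have h1 : 1 + t ≠ 0 := by positivity
      rw [show -(α + (1 - α)) = -1 by ring, Real.rpow_neg_one]
      simp only [balakrishnanCoeff, if_true, zero_add, pow_one]
      congr 1
      field_simp
      ring
    have hc' : ∀ t ∈ Set.Ioi (0 : ℝ), |balakrishnanCoeff α 0 t| = balakrishnanCoeff α 0 t := by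
      intro t ht
      have ht : 0 < t := ht
      rw [abs_of_nonneg]
      rw [hc t ht]
      positivity
    obtain ⟨h1, h2⟩ := integral_rpow_mul_one_add_rpow hα.1 (b := 1 - α) (by linarith [hα.2])
    have h3 : ∫ t in Set.Ioi (0 : ℝ), balakrishnanCoeff α 0 t =
        Real.pi / Real.sin (Real.pi * α) := by
      rw [setIntegral_congr_fun measurableSet_Ioi hc, h2, ProbabilityTheory.beta,
        Real.Gamma_mul_Gamma_one_sub]
      simp
    refine ⟨(integrableOn_congr_fun hc measurableSet_Ioi).mpr h1, ?_, ?_⟩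
    · simpa [A_zero] using h3
    · rw [setIntegral_congr_fun measurableSet_Ioi hc', h3]
      simp only [if_true, A_zero, sub_zero, mul_one]
      rw [abs_of_pos (div_pos Real.pi_pos hs)]
  · have hc : ∀ t ∈ Set.Ioi (0 : ℝ), balakrishnanCoeff α (k + 1) t =
        -(t ^ (α + 1 - 1) * (1 + t) ^ (-(α + 1 + (k + 1 - α)))) := by
      intro t ht
      have ht : 0 < t := ht
      have h1 : 0 < 1 + t := by positivity
      rw [show -(α + 1 + (k + 1 - α)) = -((k + 1 + 1 : ℕ) : ℝ) by push_cast; ring,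
        Real.rpow_neg h1.le, Real.rpow_natCast, add_sub_right_comm, Real.rpow_add_one ht.ne']
      simp [balakrishnanCoeff]
      ring
    have hc' : ∀ t ∈ Set.Ioi (0 : ℝ), |balakrishnanCoeff α (k + 1) t| =
        -balakrishnanCoeff α (k + 1) t := by
      intro t ht
      have ht : 0 < t := ht
      rw [abs_of_nonpos]
      rw [hc t ht]
      have : 0 ≤ t ^ (α + 1 - 1) * (1 + t) ^ (-(α + 1 + (k + 1 - α))) := by positivity
      linarith
    obtain ⟨h1, h2⟩ := integral_rpow_mul_one_add_rpow (a := α + 1) (b := k + 1 - α)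
      (by linarith [hα.1]) (by linarith [hα.2, (Nat.cast_nonneg k : (0 : ℝ) ≤ k)])
    have h3 : ∫ t in Set.Ioi (0 : ℝ), balakrishnanCoeff α (k + 1) t =
        Real.pi / Real.sin (Real.pi * α) * (0 - A α (k + 1)) := by
      rw [setIntegral_congr_fun measurableSet_Ioi hc, integral_neg, h2, beta_eq_A hα]
      ring
    refine ⟨(integrableOn_congr_fun hc measurableSet_Ioi).mpr h1.neg, ?_, ?_⟩
    · simpa using h3
    · rw [setIntegral_congr_fun measurableSet_Ioi hc', integral_neg, h3]
      simp only [Nat.add_eq_zero_iff, one_ne_zero, and_false, if_false]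
      rw [abs_of_nonpos]
      have := mul_nonneg (div_pos Real.pi_pos hs).le (A_nonneg hα (k + 1))
      linarith

/-! ### Subordinated operators, resolvents and fractional powers. -/

section Operators

variable {X : Type*} [NormedAddCommGroup X] [NormedSpace ℂ X] {T : X →L[ℂ] X}

lemma IsPowerBounded.exists_forall_norm_pow_le (hT : IsPowerBounded T) : ∃ M, ∀ k, ‖T ^ k‖ ≤ M := by
  obtain ⟨C, hC⟩ := hT
  -- The hypothesis starts at exponent 1; the extra 1 covers the identity, whose norm is at most 1.
  refine ⟨max 1 C, fun k => ?_⟩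
  rcases k.eq_zero_or_pos with rfl | hk
  · exact le_max_of_le_left ContinuousLinearMap.norm_id_le
  · exact le_max_of_le_right (hC k hk)

lemma inverse_smul_one_add_mul_self {V : X →L[ℂ] X} (hV : IsNonnegativeOperator V) {t : ℝ}
    (ht : 0 < t) :
    Ring.inverse ((t : ℂ) • (1 : X →L[ℂ] X) + V) * V =
      1 - (t : ℂ) • Ring.inverse ((t : ℂ) • (1 : X →L[ℂ] X) + V) := by
  have h := Ring.inverse_mul_cancel _ (hV.1 t ht)
  rw [mul_add, mul_smul_comm, mul_one] at h
  rw [eq_sub_iff_add_eq, add_comm, h]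

variable [CompleteSpace X]

lemma isRitt_Psi {F : ℕ → ℝ} (hF : F ∈ classA) (hT : IsPowerBounded T) : IsRitt (Psi F T) := by
  obtain ⟨M, hM⟩ := hT.exists_forall_norm_pow_le
  have hM0 : 0 ≤ M := (norm_nonneg _).trans (hM 0)
  obtain ⟨hF, C, hC⟩ := hF
  have hpow := hasSum_convPow_smul_pow hM hF
  refine ⟨⟨M, fun n _ => ?_⟩, C * M, fun n hn => ?_⟩
  · rw [Psi, ← (hpow n).tsum_eq]
    refine tsum_of_norm_bounded (by simpa using (hF.convPow n).2.mul_right M) fun k => ?_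
    simpa [abs_of_nonneg ((hF.convPow n).1 k).1] using norm_smul_pow_le hM (convPow F n k) k
  · obtain ⟨h1, h2⟩ := hC n hn
    have h3 := (hpow n).sub (hpow (n + 1))
    have h4 : ‖Psi F T ^ n - Psi F T ^ (n + 1)‖ ≤
        (∑' k, |convPow F n k - convPow F (n + 1) k|) * M := by
      rw [Psi, ← h3.tsum_eq]
      refine tsum_of_norm_bounded (h1.hasSum.mul_right M) fun k => ?_
      rw [← sub_smul, ← Complex.ofReal_sub]
      exact norm_smul_pow_le hM _ k
    calc (n : ℝ) * ‖Psi F T ^ n - Psi F T ^ (n + 1)‖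
        ≤ n * ((∑' k, |convPow F n k - convPow F (n + 1) k|) * M) := by gcongr
      _ = (n * ∑' k, |convPow F n k - convPow F (n + 1) k|) * M := by ring
      _ ≤ C * M := by gcongr

/-- Neumann series of `(1 + t)(1 - T / (1 + t))`: it converges because the powers of `T` are
bounded, even if `‖T‖ > 1`, and the scalar coefficients sum to `1 / t`. -/
lemma hasSum_inverse_smul_one_add_one_sub {M : ℝ} (hM : ∀ k, ‖T ^ k‖ ≤ M) {t : ℝ} (ht : 0 < t) :
    IsUnit ((t : ℂ) • (1 : X →L[ℂ] X) + (1 - T)) ∧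
      HasSum (fun k : ℕ => ((((1 + t) ^ (k + 1))⁻¹ : ℝ) : ℂ) • T ^ k)
        (Ring.inverse ((t : ℂ) • (1 : X →L[ℂ] X) + (1 - T))) ∧
      t * ‖Ring.inverse ((t : ℂ) • (1 : X →L[ℂ] X) + (1 - T))‖ ≤ M := by
  have hs : 0 < 1 + t := by positivity
  have hsC : ((1 + t : ℝ) : ℂ) ≠ 0 := Complex.ofReal_ne_zero.mpr hs.ne'
  set s : ℝ := 1 + t with hsdef
  have hgeo : HasSum (fun k : ℕ => (s ^ (k + 1))⁻¹) t⁻¹ := by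
    have h := (hasSum_geometric_of_lt_one (inv_nonneg.mpr hs.le)
      (inv_lt_one_of_one_lt₀ (by linarith : 1 < s))).mul_left s⁻¹
    have ht' : t⁻¹ = s⁻¹ * (1 - s⁻¹)⁻¹ := by
      rw [← mul_inv, mul_sub, mul_inv_cancel₀ hs.ne', hsdef]; ring
    rw [ht']
    refine (congrArg (HasSum · _) (funext fun k => ?_)).mp h
    rw [pow_succ, mul_inv, inv_pow, mul_comm]
  have hsum : Summable fun k : ℕ => (((s ^ (k + 1))⁻¹ : ℝ) : ℂ) • T ^ k :=
    (summable_norm_smul_pow hM hgeo.summable).of_norm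
  set y : X →L[ℂ] X := ((s⁻¹ : ℝ) : ℂ) • T
  have hy : ∀ k, y ^ k = (s : ℂ) • ((((s ^ (k + 1))⁻¹ : ℝ) : ℂ) • T ^ k) := by
    intro k
    simp only [y]
    rw [smul_pow, smul_smul]
    congr 1
    push_cast
    rw [pow_succ, inv_pow, mul_inv, mul_left_comm, mul_inv_cancel₀ hsC, mul_one]
  have hysum : Summable (y ^ ·) := by
    simp_rw [hy]
    exact hsum.const_smul _
  have hV : (t : ℂ) • (1 : X →L[ℂ] X) + (1 - T) = (s : ℂ) • (1 - y) := by
    simp only [y]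
    rw [smul_sub, smul_smul]
    push_cast
    rw [mul_inv_cancel₀ hsC, hsdef, one_smul]
    push_cast
    rw [add_smul, one_smul]
    abel
  have hR : ∑' k, y ^ k = (s : ℂ) • ∑' k : ℕ, (((s ^ (k + 1))⁻¹ : ℝ) : ℂ) • T ^ k := by
    simp_rw [hy]
    exact hsum.tsum_const_smul _
  set R := ∑' k : ℕ, (((s ^ (k + 1))⁻¹ : ℝ) : ℂ) • T ^ k
  let u : (X →L[ℂ] X)ˣ :=
    { val := (t : ℂ) • (1 : X →L[ℂ] X) + (1 - T)
      inv := R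
      val_inv := by rw [hV, smul_mul_assoc, ← mul_smul_comm, ← hR, hysum.one_sub_mul_tsum_pow]
      inv_val := by rw [hV, mul_smul_comm, ← smul_mul_assoc, ← hR, hysum.tsum_pow_mul_one_sub] }
  have hinv : Ring.inverse ((t : ℂ) • (1 : X →L[ℂ] X) + (1 - T)) = R := Ring.inverse_unit u
  refine ⟨u.isUnit, hinv ▸ hsum.hasSum, ?_⟩
  rw [hinv]
  have h5 : ‖R‖ ≤ t⁻¹ * M := by
    refine tsum_of_norm_bounded (hgeo.mul_right M) fun k => ?_
    simpa [abs_of_pos hs] using norm_smul_pow_le hM ((s ^ (k + 1))⁻¹) k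
  calc t * ‖R‖ ≤ t * (t⁻¹ * M) := by gcongr
    _ = M := by field_simp

lemma isNonnegativeOperator_one_sub (hT : IsPowerBounded T) : IsNonnegativeOperator (1 - T) := by
  obtain ⟨M, hM⟩ := hT.exists_forall_norm_pow_le
  exact ⟨fun t ht => (hasSum_inverse_smul_one_add_one_sub hM ht).1,
    M, fun t ht => (hasSum_inverse_smul_one_add_one_sub hM ht).2.2⟩

lemma integrableOn_balakrishnanIntegrand {V : X →L[ℂ] X} (hV : IsNonnegativeOperator V) {α : ℝ}
    (hα : α ∈ Set.Ioo (0 : ℝ) 1) :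
    IntegrableOn (balakrishnanIntegrand V α) (Set.Ioi 0) := by
  obtain ⟨M, hM⟩ := hV.2
  have hcont : ContinuousOn (balakrishnanIntegrand V α) (Set.Ioi 0) := by
    intro t ht
    refine ContinuousAt.continuousWithinAt ?_
    have h1 : ContinuousAt (fun t : ℝ => t ^ (α - 1)) t :=
      Real.continuousAt_rpow_const t _ (Or.inl (ne_of_gt ht))
    have h2 : ContinuousAt (fun t : ℝ => Ring.inverse ((t : ℂ) • (1 : X →L[ℂ] X) + V)) t := by
      obtain ⟨u, hu⟩ := hV.1 t ht
      refine ContinuousAt.comp (g := Ring.inverse)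
        (f := fun t : ℝ => (t : ℂ) • (1 : X →L[ℂ] X) + V) ?_ (by fun_prop)
      simp only [← hu]
      exact NormedRing.inverse_continuousAt u
    exact (Complex.continuous_ofReal.continuousAt.comp h1).smul (h2.mul continuousAt_const)
  have hmeas := hcont.aestronglyMeasurable (μ := volume) measurableSet_Ioi
  have hnorm : ∀ t : ℝ, 0 < t → ‖balakrishnanIntegrand V α t‖ =
      t ^ (α - 1) * ‖Ring.inverse ((t : ℂ) • (1 : X →L[ℂ] X) + V) * V‖ := by
    intro t ht
    rw [balakrishnanIntegrand, norm_smul, Complex.norm_real,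
      Real.norm_of_nonneg (Real.rpow_nonneg ht.le _)]
  rw [← Set.Ioc_union_Ioi_eq_Ioi (zero_le_one (α := ℝ))]
  -- Near 0, `(t + V)⁻¹ V = 1 - t (t + V)⁻¹` is bounded and `t^(α-1)` is integrable; near infinity
  -- the resolvent decays like `1 / t`, leaving `t^(α-2)`.
  refine IntegrableOn.union ?_ ?_
  · have h1 : IntegrableOn (fun t : ℝ => t ^ (α - 1) * (‖(1 : X →L[ℂ] X)‖ + M)) (Set.Ioc 0 1) := by
      refine Integrable.mul_const ?_ _
      exact (intervalIntegrable_iff_integrableOn_Ioc_of_le zero_le_one).mp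
        (intervalIntegral.intervalIntegrable_rpow' (by linarith [hα.1]))
    refine Integrable.mono' h1 (hmeas.mono_set Set.Ioc_subset_Ioi_self) ?_
    refine (ae_restrict_iff' measurableSet_Ioc).mpr (Eventually.of_forall fun t ht => ?_)
    rw [hnorm t ht.1, inverse_smul_one_add_mul_self hV ht.1]
    refine mul_le_mul_of_nonneg_left ((norm_sub_le _ _).trans ?_) (Real.rpow_nonneg ht.1.le _)
    rw [norm_smul, Complex.norm_real, Real.norm_of_nonneg ht.1.le]
    linarith [hM t ht.1]
  · have h1 : IntegrableOn (fun t : ℝ => t ^ (α - 2) * (M * ‖V‖)) (Set.Ioi 1) :=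
      Integrable.mul_const (integrableOn_Ioi_rpow_of_lt (by linarith [hα.2]) one_pos) _
    refine Integrable.mono' h1 (hmeas.mono_set (Set.Ioi_subset_Ioi zero_le_one)) ?_
    refine (ae_restrict_iff' measurableSet_Ioi).mpr (Eventually.of_forall fun t ht => ?_)
    have ht0 : 0 < t := zero_lt_one.trans ht
    rw [hnorm t ht0, show α - 1 = (α - 2) + 1 by ring, Real.rpow_add_one ht0.ne', mul_assoc]
    refine mul_le_mul_of_nonneg_left ?_ (Real.rpow_nonneg ht0.le _)
    calc t * ‖Ring.inverse ((t : ℂ) • (1 : X →L[ℂ] X) + V) * V‖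
        ≤ t * (‖Ring.inverse ((t : ℂ) • (1 : X →L[ℂ] X) + V)‖ * ‖V‖) := by
          gcongr
          exact norm_mul_le _ _
      _ ≤ M * ‖V‖ := by
          rw [← mul_assoc]
          exact mul_le_mul_of_nonneg_right (hM t ht0) (norm_nonneg _)

lemma Psi_A_eq {α : ℝ} (hα : α ∈ Set.Ioo (0 : ℝ) 1) (hT : IsPowerBounded T) :
    Psi (A α) T = 1 - fracPow (1 - T) α := by
  obtain ⟨M, hM⟩ := hT.exists_forall_norm_pow_le
  have hV := isNonnegativeOperator_one_sub hT
  have hs := sin_pi_mul_pos hα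
  have hone : HasSum (fun k : ℕ => (((if k = 0 then 1 else 0 : ℝ) : ℝ) : ℂ) • T ^ k) 1 := by
    refine (congrArg (HasSum · _) (funext fun k => ?_)).mp (hasSum_ite_eq (0 : ℕ) (1 : X →L[ℂ] X))
    by_cases h : k = 0 <;> simp [h]
  have hPsi : HasSum (fun k : ℕ => (((if k = 0 then 1 else 0) - A α k : ℝ) : ℂ) • T ^ k)
      (1 - Psi (A α) T) := by
    have h := hone.sub (summable_norm_smul_pow hM (summable_A hα)).of_norm.hasSum
    refine (congrArg (HasSum · _) (funext fun k => ?_)).mp h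
    rw [Complex.ofReal_sub, sub_smul]
  have hterm : ∀ t ∈ Set.Ioi (0 : ℝ),
      ∑' k, (balakrishnanCoeff α k t : ℂ) • T ^ k = balakrishnanIntegrand (1 - T) α t := by
    intro t ht
    have ht : 0 < t := ht
    rw [balakrishnanIntegrand, inverse_smul_one_add_mul_self hV ht]
    have h := (hone.sub ((hasSum_inverse_smul_one_add_one_sub hM ht).2.1.const_smul
      (t : ℂ))).const_smul ((t ^ (α - 1) : ℝ) : ℂ)
    rw [← h.tsum_eq]
    refine tsum_congr fun k => ?_
    rw [smul_smul, ← sub_smul, smul_smul, balakrishnanCoeff]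
    push_cast
    rfl
  have hnormint : ∀ k, ∫ t in Set.Ioi (0 : ℝ), ‖(balakrishnanCoeff α k t : ℂ) • T ^ k‖ =
      |Real.pi / Real.sin (Real.pi * α) * ((if k = 0 then 1 else 0) - A α k)| * ‖T ^ k‖ := by
    intro k
    simp only [norm_smul, Complex.norm_real, Real.norm_eq_abs]
    rw [integral_mul_const, (integral_balakrishnanCoeff hα k).2.2]
  have hsummable : Summable fun k : ℕ =>
      Real.pi / Real.sin (Real.pi * α) * ((if k = 0 then 1 else 0) - A α k) :=
    ((hasSum_ite_eq (0 : ℕ) (1 : ℝ)).summable.sub (summable_A hα)).mul_left _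
  have h := hasSum_integral_of_summable_integral_norm
    (F := fun k t => (balakrishnanCoeff α k t : ℂ) • T ^ k)
    (μ := volume.restrict (Set.Ioi (0 : ℝ)))
    (fun k => ((integral_balakrishnanCoeff hα k).1.ofReal).smul_const _) (by
      simp only [hnormint]
      exact Summable.of_nonneg_of_le (fun k => by positivity)
        (fun k => mul_le_mul_of_nonneg_left (hM k) (abs_nonneg _)) (hsummable.abs.mul_right M))
  rw [setIntegral_congr_fun measurableSet_Ioi hterm] at h
  have h2 := h.const_smul ((Real.sin (Real.pi * α) / Real.pi : ℝ) : ℂ)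
  have h3 : HasSum (fun k : ℕ => (((if k = 0 then 1 else 0) - A α k : ℝ) : ℂ) • T ^ k)
      (fracPow (1 - T) α) := by
    refine (congrArg (HasSum · _) (funext fun k => ?_)).mp h2
    rw [integral_smul_const, integral_complex_ofReal, (integral_balakrishnanCoeff hα k).2.1,
      smul_smul, ← Complex.ofReal_mul]
    congr 2
    have := Real.pi_ne_zero
    field_simp
  rw [← hPsi.unique h3]
  abel

end Operators

/-! ### Mixtures and the passage from `β` to `βγ`. -/

lemma coeff_eq_of_hasSum {a b : ℕ → ℂ} {f : ℂ → ℂ}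
    (ha : ∀ w : ℂ, ‖w‖ < 1 → HasSum (fun k => a k * w ^ k) (f w))
    (hb : ∀ w : ℂ, ‖w‖ < 1 → HasSum (fun k => b k * w ^ k) (f w)) : a = b := by
  have key : ∀ c : ℕ → ℂ, (∀ w : ℂ, ‖w‖ < 1 → HasSum (fun k => c k * w ^ k) (f w)) →
      HasFPowerSeriesAt f (FormalMultilinearSeries.ofScalars ℂ c) 0 := by
    intro c hc
    rw [hasFPowerSeriesAt_iff]
    filter_upwards [Metric.ball_mem_nhds (0 : ℂ) one_pos] with w hw
    simpa [FormalMultilinearSeries.coeff_ofScalars, mul_comm] using hc w (by simpa using hw)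
  exact FormalMultilinearSeries.ofScalars_series_injective ℂ ℂ
    ((key a ha).eq_formalMultilinearSeries (key b hb))

section Mixture

variable {p : ℕ → ℝ} {Q : ℕ → ℕ → ℝ}

lemma summable_mixture (hp : Summable p) (hQ : ∀ j, IsProbability (Q j)) :
    Summable (Function.uncurry fun j k => |p j| * Q j k) := by
  have h0 : 0 ≤ Function.uncurry fun j k => |p j| * Q j k :=
    fun x => mul_nonneg (abs_nonneg (p x.1)) ((hQ x.1).1 x.2).1
  rw [summable_prod_of_nonneg h0]
  refine ⟨fun j => (hQ j).2.summable.mul_left |p j|, ?_⟩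
  refine hp.abs.congr fun j => ?_
  simp only [Function.uncurry_apply_pair, tsum_mul_left, (hQ _).2.tsum_eq, mul_one]

lemma mixture_l1_le (hp : Summable p) (hQ : ∀ j, IsProbability (Q j)) :
    Summable (fun k => |∑' j, p j * Q j k|) ∧ ∑' k, |∑' j, p j * Q j k| ≤ ∑' j, |p j| := by
  have h := summable_mixture hp hQ
  have h1 : Summable fun k => ∑' j, |p j| * Q j k := h.prod_symm.prod
  have h2 : ∀ k, |∑' j, p j * Q j k| ≤ ∑' j, |p j| * Q j k := by
    intro k
    refine tsum_of_norm_bounded (f := fun j => p j * Q j k) (h.prod_symm.prod_factor k).hasSum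
      fun j => ?_
    rw [Real.norm_eq_abs, abs_mul, abs_of_nonneg ((hQ j).1 k).1]
    rfl
  have h3 := Summable.of_nonneg_of_le (fun k => abs_nonneg _) h2 h1
  refine ⟨h3, (h3.tsum_le_tsum h2 h1).trans ?_⟩
  rw [h.tsum_comm]
  simp [tsum_mul_left, (hQ _).2.tsum_eq]

lemma hasSum_mixture_mul_pow (hp : Summable p) (hQ : ∀ j, IsProbability (Q j)) {w : ℂ}
    (hw : ‖w‖ ≤ 1) :
    HasSum (fun k => ((∑' j, p j * Q j k : ℝ) : ℂ) * w ^ k)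
      (∑' j, (p j : ℂ) * ∑' k, (Q j k : ℂ) * w ^ k) := by
  have h : Summable (Function.uncurry fun j k => (p j : ℂ) * ((Q j k : ℂ) * w ^ k)) := by
    refine Summable.of_norm_bounded (summable_mixture hp hQ) fun x => ?_
    simp only [Function.uncurry, norm_mul, norm_pow, Complex.norm_real, Real.norm_eq_abs,
      abs_of_nonneg ((hQ x.1).1 x.2).1]
    gcongr
    exact mul_le_of_le_one_right ((hQ x.1).1 x.2).1 (pow_le_one₀ (norm_nonneg w) hw)
  have h1 := h.prod_symm.prod.hasSum
  have h2 := h.tsum_comm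
  simp only [Function.uncurry, Prod.swap, tsum_mul_left] at h1 h2
  rw [h2] at h1
  refine (congrArg (HasSum · _) (funext fun k => ?_)).mp h1
  rw [Complex.ofReal_tsum, ← tsum_mul_right]
  refine tsum_congr fun j => ?_
  push_cast
  ring

end Mixture

lemma norm_one_sub_cpow_le {α : ℝ} (hα : α ∈ Set.Ioo (0 : ℝ) 1) {w : ℂ} (hw : ‖w‖ ≤ 1) :
    ‖1 - (1 - w) ^ (α : ℂ)‖ ≤ 1 := by
  rw [← (hasSum_A_mul_pow hα hw).tsum_eq]
  refine tsum_of_norm_bounded (isProbability_A hα).2 fun k => ?_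
  rw [norm_mul, norm_pow, Complex.norm_real, Real.norm_of_nonneg (A_nonneg hα k)]
  exact mul_le_of_le_one_right (A_nonneg hα k) (pow_le_one₀ (norm_nonneg w) hw)

lemma norm_pow_le_one {w : ℂ} (hw : ‖w‖ ≤ 1) (k : ℕ) : ‖w ^ k‖ ≤ 1 := by
  rw [norm_pow]
  exact pow_le_one₀ (norm_nonneg w) hw

lemma hasSum_convPow_A_mul_pow {α : ℝ} (hα : α ∈ Set.Ioo (0 : ℝ) 1) (n : ℕ) {w : ℂ}
    (hw : ‖w‖ ≤ 1) :
    HasSum (fun k => (convPow (A α) n k : ℂ) * w ^ k) ((1 - (1 - w) ^ (α : ℂ)) ^ n) := by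
  rw [← (hasSum_A_mul_pow hα hw).tsum_eq]
  exact hasSum_convPow_smul_pow (norm_pow_le_one hw) (isProbability_A hα) n

/-- For `γ < 1` the angle `γ arg z` stays within the principal range, so no branch is crossed. -/
lemma cpow_mul_of_mem_Ioo {γ : ℝ} (hγ : γ ∈ Set.Ioo (0 : ℝ) 1) (β : ℝ) (z : ℂ) :
    (z ^ (γ : ℂ)) ^ (β : ℂ) = z ^ ((β * γ : ℝ) : ℂ) := by
  have h1 := Complex.neg_pi_lt_arg z
  have h2 := Complex.arg_le_pi z
  have h3 := Real.pi_pos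
  have him : (Complex.log z * γ).im = z.arg * γ := by simp [Complex.log_im]
  rw [← Complex.cpow_mul, ← Complex.ofReal_mul, mul_comm γ]
  · rw [him]; nlinarith [hγ.1, hγ.2]
  · rw [him]; nlinarith [hγ.1, hγ.2]

/-- Compare generating functions: evaluate that of the `n`-th power of `A β` at `1 - (1 - w)^γ`,
which lies in the closed disc. -/
lemma convPow_A_mul {β γ : ℝ} (hβ : β ∈ Set.Ioo (0 : ℝ) 1) (hγ : γ ∈ Set.Ioo (0 : ℝ) 1)
    (n k : ℕ) :
    convPow (A (β * γ)) n k = ∑' j, convPow (A β) n j * convPow (A γ) j k := by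
  have hα : β * γ ∈ Set.Ioo (0 : ℝ) 1 := by
    constructor <;> nlinarith [hβ.1, hβ.2, hγ.1, hγ.2]
  have h := coeff_eq_of_hasSum (a := fun k => (convPow (A (β * γ)) n k : ℂ))
    (b := fun k => ((∑' j, convPow (A β) n j * convPow (A γ) j k : ℝ) : ℂ))
    (fun w hw => hasSum_convPow_A_mul_pow hα n hw.le) (fun w hw => ?_)
  · exact_mod_cast congrFun h k
  · convert hasSum_mixture_mul_pow ((isProbability_A hβ).convPow n).2.summable
      (fun j => (isProbability_A hγ).convPow j) hw.le using 1
    simp only [(hasSum_convPow_A_mul_pow hγ _ hw.le).tsum_eq]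
    rw [(hasSum_convPow_A_mul_pow hβ n (norm_one_sub_cpow_le hγ hw.le)).tsum_eq, sub_sub_cancel,
      cpow_mul_of_mem_Ioo hγ]

lemma A_mul_mem_classA {β γ : ℝ} (hβ : β ∈ Set.Ioo (0 : ℝ) 1) (hγ : γ ∈ Set.Ioo (0 : ℝ) 1)
    (h : A β ∈ classA) : A (β * γ) ∈ classA := by
  obtain ⟨-, C, hC⟩ := h
  refine ⟨isProbability_A (by constructor <;> nlinarith [hβ.1, hβ.2, hγ.1, hγ.2]), C,
    fun n hn => ?_⟩
  have hP := fun m => ((isProbability_A hβ).convPow m).2.summable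
  have hQ := fun j => (isProbability_A hγ).convPow j
  have hd : ∀ k, convPow (A (β * γ)) n k - convPow (A (β * γ)) (n + 1) k =
      ∑' j, (convPow (A β) n j - convPow (A β) (n + 1) j) * convPow (A γ) j k := by
    intro k
    have hs : ∀ m, Summable fun j => convPow (A β) m j * convPow (A γ) j k := fun m =>
      Summable.of_norm_bounded ((summable_mixture (hP m) hQ).prod_symm.prod_factor k) fun j => by
        rw [Real.norm_eq_abs, abs_mul, abs_of_nonneg ((hQ j).1 k).1]
        rfl
    rw [convPow_A_mul hβ hγ, convPow_A_mul hβ hγ, ← (hs n).tsum_sub (hs (n + 1))]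
    exact tsum_congr fun j => (sub_mul _ _ _).symm
  simp only [hd]
  obtain ⟨h1, h2⟩ := mixture_l1_le ((hP n).sub (hP (n + 1))) hQ
  exact ⟨h1, (mul_le_mul_of_nonneg_left h2 n.cast_nonneg).trans (hC n hn).2⟩

/-! ### Parseval's identity and differentiation of power series. -/

lemma integral_exp_int_mul_I (m : ℤ) :
    ∫ θ in (-Real.pi)..Real.pi, Complex.exp (m * Complex.I * θ) =
      if m = 0 then 2 * (Real.pi : ℂ) else 0 := by
  split_ifs with h
  · simp [h]; ring
  · rw [integral_exp_mul_complex (by simp [h])]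
    have h1 : Complex.exp (m * Complex.I * (Real.pi : ℝ)) =
        Complex.exp (m * Complex.I * ((-Real.pi : ℝ) : ℂ)) := by
      rw [Complex.exp_eq_exp_iff_exists_int]
      exact ⟨m, by push_cast; ring⟩
    rw [h1, sub_self, zero_div]

lemma hasSum_sq_norm_integral {a : ℕ → ℂ} (ha : Summable fun k => ‖a k‖) {h : ℝ → ℂ}
    (hh : ∀ θ : ℝ, HasSum (fun k : ℕ => a k * Complex.exp (θ * Complex.I) ^ k) (h θ)) :
    Continuous h ∧
      HasSum (fun k => 2 * Real.pi * ‖a k‖ ^ 2) (∫ θ in (-Real.pi)..Real.pi, ‖h θ‖ ^ 2) := by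
  have hcont : Continuous h := by
    have : h = fun θ : ℝ => ∑' k, a k * Complex.exp (θ * Complex.I) ^ k :=
      funext fun θ => (hh θ).tsum_eq.symm
    rw [this]
    refine continuous_tsum (fun k => by fun_prop) ha fun k θ => ?_
    simp [Complex.norm_exp_ofReal_mul_I]
  have hbound : ∀ θ, ‖h θ‖ ≤ ∑' k, ‖a k‖ := by
    intro θ
    rw [← (hh θ).tsum_eq]
    refine tsum_of_norm_bounded ha.hasSum fun k => ?_
    simp [Complex.norm_exp_ofReal_mul_I]
  have hconj : ∀ (θ : ℝ) (k : ℕ), (starRingEnd ℂ) (Complex.exp (θ * Complex.I) ^ k) =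
      Complex.exp (((-k : ℤ) : ℂ) * Complex.I * θ) := by
    intro θ k
    rw [map_pow, ← Complex.exp_conj, ← Complex.exp_nat_mul]
    congr 1
    simp
    ring
  have hcoeff : ∀ j : ℕ, ∫ θ in (-Real.pi)..Real.pi,
      h θ * (starRingEnd ℂ) (Complex.exp (θ * Complex.I) ^ j) = a j * (2 * Real.pi) := by
    intro j
    have h1 := intervalIntegral.hasSum_integral_of_dominated_convergence (a := -Real.pi)
      (b := Real.pi) (μ := volume) (fun k _ => ‖a k‖)
      (F := fun k θ => a k * Complex.exp (θ * Complex.I) ^ k *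
        (starRingEnd ℂ) (Complex.exp (θ * Complex.I) ^ j))
      (f := fun θ => h θ * (starRingEnd ℂ) (Complex.exp (θ * Complex.I) ^ j))
      (fun k => (by fun_prop : Continuous _).aestronglyMeasurable)
      (fun k => Eventually.of_forall fun θ _ => by simp [Complex.norm_exp_ofReal_mul_I])
      (Eventually.of_forall fun θ _ => ha) (by simp)
      (Eventually.of_forall fun θ _ => (hh θ).mul_right _)
    have h2 : ∀ k : ℕ, ∫ θ in (-Real.pi)..Real.pi, a k * Complex.exp (θ * Complex.I) ^ k *
        (starRingEnd ℂ) (Complex.exp (θ * Complex.I) ^ j) =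
        if k = j then a j * (2 * Real.pi) else 0 := by
      intro k
      have h3 : ∀ θ : ℝ, a k * Complex.exp (θ * Complex.I) ^ k *
          (starRingEnd ℂ) (Complex.exp (θ * Complex.I) ^ j) =
          a k * Complex.exp (((k - j : ℤ) : ℂ) * Complex.I * θ) := by
        intro θ
        rw [hconj, ← Complex.exp_nat_mul, mul_assoc, ← Complex.exp_add]
        congr 2
        push_cast
        ring
      simp_rw [h3]
      rw [intervalIntegral.integral_const_mul, integral_exp_int_mul_I]
      simp only [sub_eq_zero, Nat.cast_inj]
      split_ifs with h4
      · rw [h4]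
      · simp
    simp only [h2] at h1
    exact h1.unique (hasSum_ite_eq j _)
  -- Expand only the conjugate factor of `‖h‖²`; the resulting integrals are the Fourier
  -- coefficients in `hcoeff`.
  have h1 := intervalIntegral.hasSum_integral_of_dominated_convergence (a := -Real.pi)
      (b := Real.pi) (μ := volume) (fun k _ => ‖a k‖ * ∑' k, ‖a k‖)
      (F := fun k θ => (starRingEnd ℂ) (a k) *
        (h θ * (starRingEnd ℂ) (Complex.exp (θ * Complex.I) ^ k)))
      (f := fun θ => ((‖h θ‖ ^ 2 : ℝ) : ℂ))
      (fun k => (by fun_prop : Continuous _).aestronglyMeasurable)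
      (fun k => Eventually.of_forall fun θ _ => by
        simp only [norm_mul, RCLike.norm_conj, norm_pow, Complex.norm_exp_ofReal_mul_I, one_pow,
          mul_one]
        gcongr
        exact hbound θ)
      (Eventually.of_forall fun θ _ => ha.mul_right _) (by simp)
      (Eventually.of_forall fun θ _ => by
        have h2 := (Complex.hasSum_conj'.mpr (hh θ)).mul_left (h θ)
        have h3 : h θ * (starRingEnd ℂ) (h θ) = ((‖h θ‖ ^ 2 : ℝ) : ℂ) := by
          rw [Complex.mul_conj, Complex.normSq_eq_norm_sq]
        rw [h3] at h2
        refine (congrArg (HasSum · _) (funext fun k => ?_)).mp h2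
        rw [map_mul]
        ring)
  simp only [intervalIntegral.integral_const_mul, hcoeff] at h1
  rw [intervalIntegral.integral_ofReal] at h1
  refine ⟨hcont, ?_⟩
  rw [← Complex.hasSum_ofReal]
  refine (congrArg (HasSum · _) (funext fun k => ?_)).mp h1
  rw [← mul_assoc, mul_comm ((starRingEnd ℂ) _), Complex.mul_conj, Complex.normSq_eq_norm_sq]
  push_cast
  ring

lemma hasDerivAt_tsum_mul_pow {a : ℕ → ℂ} (ha : Summable fun k => ‖a k‖) {w : ℂ} (hw : ‖w‖ < 1) :
    HasDerivAt (fun z : ℂ => ∑' k, a k * z ^ k) (∑' k : ℕ, a k * (k * w ^ (k - 1))) w ∧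
      Summable (fun k : ℕ => ‖a k * (k * w ^ (k - 1))‖) := by
  obtain ⟨r, hr1, hr2⟩ := exists_between hw
  have hr0 : 0 ≤ r := (norm_nonneg w).trans hr1.le
  have hu : Summable fun k : ℕ => ‖a k‖ * (k * r ^ (k - 1)) := by
    have h1 : Summable fun k : ℕ => (k : ℝ) * r ^ (k - 1) := by
      rw [← summable_nat_add_iff 1]
      have h2 := (summable_pow_mul_geometric_of_norm_lt_one 1
        (by rwa [Real.norm_of_nonneg hr0] : ‖r‖ < 1)).add
        (summable_geometric_of_lt_one hr0 hr2)
      refine h2.congr fun k => ?_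
      push_cast
      simp
      ring
    have h3 : ∀ k, ‖a k‖ ≤ ∑' j, ‖a j‖ := fun k => ha.le_tsum k fun _ _ => norm_nonneg _
    exact Summable.of_nonneg_of_le (fun k => by positivity)
      (fun k => mul_le_mul_of_nonneg_right (h3 k) (by positivity)) (h1.mul_left _)
  have hb : ∀ (k : ℕ) (z : ℂ), z ∈ Metric.ball (0 : ℂ) r →
      ‖a k * (k * z ^ (k - 1))‖ ≤ ‖a k‖ * (k * r ^ (k - 1)) := by
    intro k z hz
    rw [norm_mul, norm_mul, norm_pow, Complex.norm_natCast]
    have : ‖z‖ ≤ r := by simpa using (Metric.mem_ball.mp hz).le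
    gcongr
  have hwr : w ∈ Metric.ball (0 : ℂ) r := by simpa using hr1
  have h0 : (0 : ℂ) ∈ Metric.ball (0 : ℂ) r := by
    simpa using (norm_nonneg w).trans_lt hr1
  refine ⟨hasDerivAt_tsum_of_isPreconnected hu Metric.isOpen_ball
    (convex_ball (0 : ℂ) r).isPreconnected (g := fun k z => a k * z ^ k)
    (g' := fun k z => a k * (k * z ^ (k - 1)))
    (fun k z _ => (hasDerivAt_pow k z).const_mul (a k)) hb h0 ?_ hwr, ?_⟩
  · refine summable_of_ne_finset_zero (s := {0}) fun k hk => ?_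
    simp [Finset.notMem_singleton.mp hk]
  · exact Summable.of_nonneg_of_le (fun _ => norm_nonneg _) (fun k => hb k w hwr) hu

lemma hasSum_nat_mul_pow_of_hasDerivAt {a : ℕ → ℂ} (ha : Summable fun k => ‖a k‖) {f : ℂ → ℂ}
    (hf : ∀ z : ℂ, ‖z‖ < 1 → HasSum (fun k => a k * z ^ k) (f z)) {w f' : ℂ} (hw : ‖w‖ < 1)
    (hf' : HasDerivAt f f' w) :
    HasSum (fun k : ℕ => (k * a k) * w ^ k) (w * f') := by
  obtain ⟨h1, h2⟩ := hasDerivAt_tsum_mul_pow ha hw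
  have h3 : f =ᶠ[𝓝 w] fun z : ℂ => ∑' k, a k * z ^ k := by
    filter_upwards [Metric.isOpen_ball.mem_nhds
      (show w ∈ Metric.ball (0 : ℂ) 1 by simpa using hw)] with z hz
    exact (hf z (by simpa using hz)).tsum_eq.symm
  rw [hf'.unique (h1.congr_of_eventuallyEq h3)]
  refine (congrArg (HasSum · _) (funext fun k => ?_)).mp (h2.of_norm.hasSum.mul_left w)
  rcases k with _ | k
  · simp
  · rw [Nat.add_sub_cancel, pow_succ]
    ring

/-! ### Decay of `1 - (1 - w)^β` on the closed disc. -/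

lemma norm_ofReal_add_ofReal_mul_le {a b : ℝ} (ha : 0 < a) (hb : 0 < b) {w : ℂ} (hw : ‖w‖ ≤ 1) :
    ‖(a : ℂ) + b * w‖ ≤ (a + b) - a * b / (2 * (a + b)) * ‖1 - w‖ ^ 2 := by
  have hab : 0 < a + b := by positivity
  have hw2 : w.re * w.re + w.im * w.im ≤ 1 := by
    rw [← Complex.normSq_apply, Complex.normSq_eq_norm_sq]
    exact pow_le_one₀ (norm_nonneg w) hw
  have h1 : ‖1 - w‖ ^ 2 ≤ 4 := by
    have : ‖1 - w‖ ≤ 2 := (norm_sub_le _ _).trans (by rw [norm_one]; linarith)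
    nlinarith [norm_nonneg (1 - w)]
  have h2 : a * b / (2 * (a + b)) * ‖1 - w‖ ^ 2 ≤ a + b := by
    rw [div_mul_eq_mul_div, div_le_iff₀ (by positivity)]
    nlinarith [mul_le_mul_of_nonneg_left h1 (mul_pos ha hb).le, sq_nonneg (a - b)]
  refine abs_le_of_sq_le_sq' ?_ (by linarith) |>.2
  have h3 : (a * b / (2 * (a + b)) * ‖1 - w‖ ^ 2) * (2 * (a + b)) = a * b * ‖1 - w‖ ^ 2 := by
    field_simp
  have h4 : ‖(a : ℂ) + b * w‖ ^ 2 ≤ (a + b) ^ 2 - a * b * ‖1 - w‖ ^ 2 := by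
    rw [← Complex.normSq_eq_norm_sq, ← Complex.normSq_eq_norm_sq, Complex.normSq_apply,
      Complex.normSq_apply]
    simp
    nlinarith [mul_pos ha hb, mul_pos hb hb, mul_le_mul_of_nonneg_left hw2 (mul_pos ha hb).le,
      mul_le_mul_of_nonneg_left hw2 (mul_pos hb hb).le]
  nlinarith [sq_nonneg (a * b / (2 * (a + b)) * ‖1 - w‖ ^ 2)]

/-- The terms of degree 1 and 2 have positive coefficients, so their sum loses a multiple of `‖1 -
w‖²` against its maximum; the tail is bounded by its total mass. -/
lemma norm_one_sub_cpow_le_one_sub {β : ℝ} (hβ : β ∈ Set.Ioo (0 : ℝ) 1) :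
    ∃ κ > 0, ∀ w : ℂ, ‖w‖ ≤ 1 → ‖1 - (1 - w) ^ (β : ℂ)‖ ≤ 1 - κ * ‖1 - w‖ ^ 2 := by
  have h1 : A β 1 = β := by simp [A]
  have h2 : A β 2 = β * (1 - β) / 2 := by rw [A_succ_succ β 0, h1]; simp; ring
  have h1' : 0 < A β 1 := by rw [h1]; exact hβ.1
  have h2' : 0 < A β 2 := by
    rw [h2]
    have := hβ.1
    have := sub_pos.mpr hβ.2
    positivity
  refine ⟨A β 1 * A β 2 / (2 * (A β 1 + A β 2)), by positivity, fun w hw => ?_⟩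
  have h3 := (hasSum_nat_add_iff' 3).mpr (hasSum_A_mul_pow hβ hw)
  have h4 := (hasSum_nat_add_iff' 3).mpr (isProbability_A hβ).2
  simp only [Finset.sum_range_succ, Finset.range_zero, Finset.sum_empty, A_zero, zero_add] at h3 h4
  have h5 := tsum_of_norm_bounded h4 fun k => (show ‖(A β (k + 3) : ℂ) * w ^ (k + 3)‖ ≤ _ by
    rw [norm_mul, norm_pow, Complex.norm_real, Real.norm_of_nonneg (A_nonneg hβ _)]
    exact mul_le_of_le_one_right (A_nonneg hβ _) (pow_le_one₀ (norm_nonneg w) hw))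
  rw [h3.tsum_eq] at h5
  have h6 : ‖(A β 1 : ℂ) * w + A β 2 * w ^ 2‖ ≤ ‖(A β 1 : ℂ) + A β 2 * w‖ := by
    rw [show (A β 1 : ℂ) * w + A β 2 * w ^ 2 = (A β 1 + A β 2 * w) * w by ring, norm_mul]
    exact mul_le_of_le_one_right (norm_nonneg _) hw
  have h7 := norm_ofReal_add_ofReal_mul_le h1' h2' hw
  have h8 := norm_add_le (1 - (1 - w) ^ (β : ℂ) -
    ((A β 1 : ℂ) * w + A β 2 * w ^ 2)) ((A β 1 : ℂ) * w + A β 2 * w ^ 2)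
  rw [sub_add_cancel] at h8
  simp at h5
  linarith

lemma norm_one_sub_cpow_le_exp {β : ℝ} (hβ : β ∈ Set.Ioo (1 / 2 : ℝ) 1) :
    ∃ c : ℝ, 0 < c ∧ c ≤ 1 ∧ ∀ w : ℂ, ‖w‖ ≤ 1 →
      ‖1 - (1 - w) ^ (β : ℂ)‖ ≤ Real.exp (-(c * ‖1 - w‖ ^ β)) := by
  have hβ0 : 0 < β := by linarith [hβ.1]
  obtain ⟨κ, hκ, hκw⟩ := norm_one_sub_cpow_le_one_sub (β := β) ⟨hβ0, hβ.2⟩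
  have hpi := Real.pi_pos
  set δ := Real.cos (Real.pi / 2 * β)
  have hδ : 0 < δ := Real.cos_pos_of_mem_Ioo ⟨by nlinarith, by nlinarith [hβ.2]⟩
  have hδ1 : δ ≤ 1 := Real.cos_le_one _
  -- The constant `δ / 2` serves where `ρ^β ≤ δ`, through the sector bound `Re ζ ≥ δ‖ζ‖`; `κ δ³`
  -- serves elsewhere, through the quadratic bound.
  refine ⟨min (δ / 2) (κ * δ ^ 3), by positivity, (min_le_left _ _).trans (by linarith),
    fun w hw => ?_⟩
  set ρ := ‖1 - w‖
  have hρ : 0 ≤ ρ := norm_nonneg _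
  have hx : 0 ≤ ρ ^ β := Real.rpow_nonneg hρ β
  rcases le_or_gt (ρ ^ β) δ with h | h
  · have hre : δ * ρ ^ β ≤ ((1 - w) ^ (β : ℂ)).re := by
      rw [Complex.cpow_ofReal_re, mul_comm]
      refine mul_le_mul_of_nonneg_left ?_ hx
      have harg : |(1 - w).arg| ≤ Real.pi / 2 := by
        rw [Complex.abs_arg_le_pi_div_two_iff]
        simpa using (Complex.re_le_norm w).trans hw
      rw [← Real.cos_abs ((1 - w).arg * β), abs_mul, abs_of_pos hβ0]
      exact Real.cos_le_cos_of_nonneg_of_le_pi (by positivity) (by nlinarith [hβ.2]) (by gcongr)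
    have hsq : ‖1 - (1 - w) ^ (β : ℂ)‖ ^ 2 ≤ 1 - δ * ρ ^ β := by
      have h1 : ‖(1 - w) ^ (β : ℂ)‖ ^ 2 = (ρ ^ β) ^ 2 := by rw [Complex.norm_cpow_real]
      generalize (1 - w) ^ (β : ℂ) = ζ at h1 hre ⊢
      rw [← Complex.normSq_eq_norm_sq, Complex.normSq_apply] at h1 ⊢
      simp only [Complex.sub_re, Complex.sub_im, Complex.one_re, Complex.one_im]
      nlinarith
    have h2 : ‖1 - (1 - w) ^ (β : ℂ)‖ ^ 2 ≤ Real.exp (-(δ / 2 * ρ ^ β)) ^ 2 := by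
      rw [← Real.exp_nat_mul]
      refine hsq.trans ((Real.one_sub_le_exp_neg _).trans (le_of_eq ?_))
      congr 1
      push_cast
      ring
    refine (abs_le_of_sq_le_sq' h2 (Real.exp_pos _).le).2.trans (Real.exp_le_exp.mpr ?_)
    have := mul_le_mul_of_nonneg_right (min_le_left (δ / 2) (κ * δ ^ 3)) hx
    linarith
  · refine (hκw w hw).trans ((Real.one_sub_le_exp_neg _).trans (Real.exp_le_exp.mpr ?_))
    have h1 : δ ^ 3 * ρ ^ β ≤ ρ ^ 2 := by
      rcases le_or_gt 1 ρ with h1 | h1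
      · have h2 : ρ ^ β ≤ ρ ^ (2 : ℝ) := Real.rpow_le_rpow_of_exponent_le h1 (by linarith [hβ.2])
        rw [Real.rpow_two] at h2
        exact (mul_le_of_le_one_left hx (pow_le_one₀ hδ.le hδ1)).trans h2
      · have hρ0 : 0 < ρ := by
          rcases hρ.eq_or_lt with h0 | h0
          · rw [← h0, Real.zero_rpow hβ0.ne'] at h
            linarith
          · exact h0
        -- As `4β ≥ 2` and `ρ < 1`, `δ³ ρ^β ≤ (ρ^β)^4 ≤ ρ²`.
        have h2 : ρ ^ (β * (4 : ℕ)) ≤ ρ ^ (2 : ℝ) :=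
          Real.rpow_le_rpow_of_exponent_ge hρ0 h1.le (by push_cast; linarith [hβ.1])
        rw [Real.rpow_two, Real.rpow_mul_natCast hρ] at h2
        refine le_trans ?_ h2
        rw [pow_succ (ρ ^ β) 3]
        gcongr
    have := mul_le_mul_of_nonneg_right (min_le_right (δ / 2) (κ * δ ^ 3)) hx
    nlinarith

lemma abs_div_pi_le_norm_one_sub {r θ : ℝ} (hr : 1 / 2 ≤ r) (hθ : |θ| ≤ Real.pi) :
    |θ| / Real.pi ≤ ‖1 - r * Complex.exp (θ * Complex.I)‖ := by
  refine (abs_le_of_sq_le_sq' ?_ (norm_nonneg _)).2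
  rw [← Complex.normSq_eq_norm_sq, Complex.normSq_apply, Complex.exp_mul_I, ← Complex.ofReal_cos,
    ← Complex.ofReal_sin]
  simp only [Complex.sub_re, Complex.one_re, Complex.sub_im, Complex.one_im, Complex.mul_re,
    Complex.mul_im, Complex.add_re, Complex.add_im, Complex.ofReal_re, Complex.ofReal_im,
    Complex.I_re, Complex.I_im]
  have h1 := Real.cos_le_one_sub_mul_cos_sq hθ
  have h2 := Real.sin_sq_add_cos_sq θ
  rw [div_pow, sq_abs]
  have h3 : 2 / Real.pi ^ 2 * θ ^ 2 = 2 * (θ ^ 2 / Real.pi ^ 2) := by ring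
  have h4 : 0 ≤ θ ^ 2 / Real.pi ^ 2 := by positivity
  nlinarith [sq_nonneg (1 - r), mul_nonneg (sub_nonneg.mpr hr) (sub_nonneg.mpr (Real.cos_le_one θ))]

/-! ### Cauchy–Schwarz with weights, and bounds for powers. -/

/-- Telescoping: each term is at most `2 / ((L + k)² - 1/4)`, a difference of consecutive values of
`2 / (L + k - 1/2)`. -/
lemma sum_inv_sq_add_sq_le {L : ℝ} (hL : 1 ≤ L) (K : ℕ) :
    ∑ k ∈ Finset.range K, (L ^ 2 + (k : ℝ) ^ 2)⁻¹ ≤ 4 / L := by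
  have h : ∑ k ∈ Finset.range K, (L ^ 2 + (k : ℝ) ^ 2)⁻¹ ≤
      2 / (L - 1 / 2) - 2 / (L + K - 1 / 2) := by
    induction K with
    | zero => simp
    | succ K ih =>
      rw [Finset.sum_range_succ]
      have hK : (0 : ℝ) ≤ K := K.cast_nonneg
      have h1 : 0 < L + K - 1 / 2 := by linarith
      have h2 : 0 < L + K + 1 / 2 := by linarith
      have h3 : (L ^ 2 + (K : ℝ) ^ 2)⁻¹ ≤ 2 / (L + K - 1 / 2) - 2 / (L + K + 1 / 2) := by
        rw [div_sub_div _ _ h1.ne' h2.ne', inv_eq_one_div, div_le_div_iff₀ (by positivity)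
          (by positivity)]
        nlinarith [sq_nonneg (L - K)]
      have h4 : L + ((K + 1 : ℕ) : ℝ) - 1 / 2 = L + K + 1 / 2 := by push_cast; ring
      rw [h4]
      linarith
  have hK : (0 : ℝ) ≤ K := K.cast_nonneg
  have h1 : 0 ≤ 2 / (L + K - 1 / 2) := div_nonneg (by norm_num) (by linarith)
  have h2 : 2 / (L - 1 / 2) ≤ 4 / L := by
    rw [div_le_div_iff₀ (by linarith) (by linarith)]
    linarith
  linarith

lemma sum_abs_sq_le {c : ℕ → ℝ} {L D : ℝ} (hL : 1 ≤ L) (K : ℕ)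
    (h : ∑ k ∈ Finset.range K, (L ^ 2 + (k : ℝ) ^ 2) * c k ^ 2 ≤ D) :
    (∑ k ∈ Finset.range K, |c k|) ^ 2 ≤ 4 / L * D := by
  refine (Finset.sum_sq_le_sum_mul_sum_of_sq_le_mul (Finset.range K)
    (f := fun k => (L ^ 2 + (k : ℝ) ^ 2)⁻¹) (g := fun k => (L ^ 2 + (k : ℝ) ^ 2) * c k ^ 2)
    (fun k _ => by positivity) (fun k _ => by positivity) fun k _ => ?_).trans ?_
  · rw [sq_abs, inv_mul_cancel_left₀ (by positivity)]
  · exact mul_le_mul (sum_inv_sq_add_sq_le hL K) h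
      (Finset.sum_nonneg fun k _ => by positivity) (by positivity)

lemma integral_abs_rpow_mul_exp {p q b : ℝ} (hp : 0 < p) (hq : -1 < q) (hb : 0 < b) :
    Integrable (fun t : ℝ => |t| ^ q * Real.exp (-b * |t| ^ p)) ∧
      ∫ t : ℝ, |t| ^ q * Real.exp (-b * |t| ^ p) =
        2 / p * Real.Gamma ((q + 1) / p) * b ^ (-(q + 1) / p) := by
  have h := integral_comp_abs (f := fun t : ℝ => t ^ q * Real.exp (-b * t ^ p))
  rw [integral_rpow_mul_exp_neg_mul_rpow hp hq hb] at h
  have hG := Real.Gamma_pos_of_pos (show 0 < (q + 1) / p from div_pos (by linarith) hp)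
  -- A non-integrable function would have integral 0 by convention, whereas the value found is
  -- positive.
  refine ⟨.of_integral_ne_zero (by rw [h]; positivity), ?_⟩
  rw [h]
  ring

section PowerEstimates

variable {ζ : ℂ} {c : ℝ}

/-- The difference is `(1 - ζ)^n ζ`; half of the exponential decay absorbs the factor `‖ζ‖` at the
price `2 / (c n)`. -/
lemma norm_pow_sub_pow_succ_sq_le (hc : 0 < c) (h : ‖1 - ζ‖ ≤ Real.exp (-(c * ‖ζ‖))) {n : ℕ}
    (hn : 1 ≤ n) :
    ‖(1 - ζ) ^ n - (1 - ζ) ^ (n + 1)‖ ^ 2 ≤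
      4 / c ^ 2 * ((n : ℝ) ^ 2)⁻¹ * Real.exp (-(c * n * ‖ζ‖)) := by
  have hn' : (0 : ℝ) < n := by exact_mod_cast hn
  set x := ‖ζ‖
  have h1 : ‖(1 - ζ) ^ n - (1 - ζ) ^ (n + 1)‖ ≤
      2 / (c * n) * Real.exp (-(c * n * x / 2)) := by
    rw [show (1 - ζ) ^ n - (1 - ζ) ^ (n + 1) = (1 - ζ) ^ n * ζ by ring, norm_mul, norm_pow]
    have h2 : x ≤ 2 / (c * n) * Real.exp (c * n * x / 2) := by
      have := Real.add_one_le_exp (c * n * x / 2)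
      rw [div_mul_eq_mul_div, le_div_iff₀ (by positivity)]
      linarith
    calc ‖1 - ζ‖ ^ n * x ≤ Real.exp (-(c * x)) ^ n * (2 / (c * n) * Real.exp (c * n * x / 2)) := by
          gcongr
      _ = 2 / (c * n) * (Real.exp (n * -(c * x)) * Real.exp (c * n * x / 2)) := by
          rw [Real.exp_nat_mul]; ring
      _ = 2 / (c * n) * Real.exp (-(c * n * x / 2)) := by
          rw [← Real.exp_add]; congr 2; ring
  calc _ ≤ (2 / (c * n) * Real.exp (-(c * n * x / 2))) ^ 2 := by gcongr
    _ = 4 / c ^ 2 * ((n : ℝ) ^ 2)⁻¹ * Real.exp ((2 : ℕ) * -(c * n * x / 2)) := by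
        rw [Real.exp_nat_mul]; field_simp; norm_num
    _ = _ := by congr 2; push_cast; ring

/-- The expression equals `(1 - ζ)^(n-1) ((n + 1) ζ - 1)`. Half of the decay absorbs the linear
factor; `exp 2` pays for the exponent `n - 1` in place of `n`, since `c‖ζ‖ ≤ 2`. -/
lemma norm_natCast_mul_pow_sub_sq_le (hc : 0 < c) (hc1 : c ≤ 1)
    (h : ‖1 - ζ‖ ≤ Real.exp (-(c * ‖ζ‖))) (hζ : ‖ζ‖ ≤ 2) {n : ℕ} (hn : 1 ≤ n) :
    ‖(n : ℂ) * (1 - ζ) ^ (n - 1) - ((n + 1 : ℕ) : ℂ) * (1 - ζ) ^ n‖ ^ 2 ≤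
      (Real.exp 2 * (1 + 4 / c)) ^ 2 * Real.exp (-(c * n * ‖ζ‖)) := by
  obtain ⟨m, rfl⟩ := Nat.exists_eq_add_of_le' hn
  set x := ‖ζ‖
  have hx : 0 ≤ x := norm_nonneg ζ
  have hm : (0 : ℝ) ≤ m := m.cast_nonneg
  set y : ℝ := c * (m + 1 : ℕ) * x / 2
  have hy : 0 ≤ y := by positivity
  have h1 : ‖((m + 1 : ℕ) : ℂ) * (1 - ζ) ^ (m + 1 - 1) -
      ((m + 1 + 1 : ℕ) : ℂ) * (1 - ζ) ^ (m + 1)‖ ≤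
      Real.exp 2 * (1 + 4 / c) * Real.exp (-y) := by
    rw [Nat.add_sub_cancel, show ((m + 1 : ℕ) : ℂ) * (1 - ζ) ^ m -
      ((m + 1 + 1 : ℕ) : ℂ) * (1 - ζ) ^ (m + 1) = (1 - ζ) ^ m * (((m + 2 : ℕ) : ℂ) * ζ - 1) by
      push_cast; ring, norm_mul, norm_pow]
    have h2 : ‖((m + 2 : ℕ) : ℂ) * ζ - 1‖ ≤ (1 + 4 / c) * Real.exp y := by
      refine (norm_sub_le _ _).trans ?_
      rw [norm_mul, Complex.norm_natCast, norm_one]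
      have h3 := Real.add_one_le_exp y
      have h4 : 4 / c * y = 2 * (m + 1) * x := by
        simp only [y]
        field_simp
        push_cast
        ring
      have h5 := mul_le_mul_of_nonneg_left h3 (show 0 ≤ 4 / c by positivity)
      have h6 : 0 < 4 / c := by positivity
      push_cast
      nlinarith [mul_nonneg hm hx]
    have h3 : ‖1 - ζ‖ ^ m ≤ Real.exp 2 * Real.exp (-(2 * y)) := by
      calc ‖1 - ζ‖ ^ m ≤ Real.exp (-(c * x)) ^ m := by gcongr
        _ = Real.exp (m * -(c * x)) := by rw [Real.exp_nat_mul]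
        _ ≤ Real.exp (2 + -(2 * y)) := by
            rw [Real.exp_le_exp]
            simp only [y]
            push_cast
            nlinarith
        _ = _ := Real.exp_add _ _
    calc ‖1 - ζ‖ ^ m * ‖((m + 2 : ℕ) : ℂ) * ζ - 1‖
        ≤ (Real.exp 2 * Real.exp (-(2 * y))) * ((1 + 4 / c) * Real.exp y) := by gcongr
      _ = Real.exp 2 * (1 + 4 / c) * (Real.exp (-(2 * y)) * Real.exp y) := by ring
      _ = _ := by rw [← Real.exp_add]; congr 2; ring
  calc _ ≤ (Real.exp 2 * (1 + 4 / c) * Real.exp (-y)) ^ 2 := by gcongr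
    _ = (Real.exp 2 * (1 + 4 / c)) ^ 2 * Real.exp ((2 : ℕ) * -y) := by
        rw [Real.exp_nat_mul]; ring
    _ = _ := by congr 2; simp only [y]; push_cast; ring

end PowerEstimates

lemma hasDerivAt_pow_sub_pow_succ (β : ℝ) (n : ℕ) {w : ℂ} (hw : ‖w‖ < 1) :
    HasDerivAt (fun z : ℂ => (1 - (1 - z) ^ (β : ℂ)) ^ n - (1 - (1 - z) ^ (β : ℂ)) ^ (n + 1))
      ((n * (1 - (1 - w) ^ (β : ℂ)) ^ (n - 1) -
        ((n + 1 : ℕ) : ℂ) * (1 - (1 - w) ^ (β : ℂ)) ^ n) *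
        (β * (1 - w) ^ ((β - 1 : ℝ) : ℂ))) w := by
  have hs : 1 - w ∈ Complex.slitPlane := by
    left
    have := (Complex.re_le_norm w).trans_lt hw
    simpa using this
  have h1 : HasDerivAt (fun z : ℂ => 1 - (1 - z) ^ (β : ℂ))
      (β * (1 - w) ^ ((β - 1 : ℝ) : ℂ)) w := by
    have h2 := (((hasDerivAt_id w).const_sub 1).cpow_const (c := (β : ℂ)) hs).const_sub 1
    refine h2.congr_deriv ?_
    push_cast
    simp
  refine ((h1.pow n).sub (h1.pow (n + 1))).congr_deriv ?_
  simp
  ring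

/-! ### The weighted ℓ² estimate for `β > 1/2`. -/

section WeightedEstimate

variable {β c : ℝ}

lemma norm_sq_bounds (hβ : β ∈ Set.Ioo (1 / 2 : ℝ) 1) (hc : 0 < c) (hc1 : c ≤ 1) {w : ℂ}
    (hw : ‖w‖ < 1) (h : ‖1 - (1 - w) ^ (β : ℂ)‖ ≤ Real.exp (-(c * ‖1 - w‖ ^ β))) {n : ℕ}
    (hn : 1 ≤ n) {t : ℝ} (ht : 0 < t) (htw : t / Real.pi ≤ ‖1 - w‖) :
    ‖(1 - (1 - w) ^ (β : ℂ)) ^ n - (1 - (1 - w) ^ (β : ℂ)) ^ (n + 1)‖ ^ 2 ≤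
        4 / c ^ 2 * ((n : ℝ) ^ 2)⁻¹ * (t ^ (0 : ℝ) * Real.exp (-(c / 4 * n) * t ^ β)) ∧
      ‖w * ((n * (1 - (1 - w) ^ (β : ℂ)) ^ (n - 1) -
        ((n + 1 : ℕ) : ℂ) * (1 - (1 - w) ^ (β : ℂ)) ^ n) *
        (β * (1 - w) ^ ((β - 1 : ℝ) : ℂ)))‖ ^ 2 ≤
        4 * (Real.exp 2 * (1 + 4 / c)) ^ 2 *
          (t ^ (2 * β - 2) * Real.exp (-(c / 4 * n) * t ^ β)) := by
  have hβ0 : 0 < β := by linarith [hβ.1]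
  have hpi := Real.pi_pos
  have hn0 : (0 : ℝ) ≤ n := n.cast_nonneg
  set ρ := ‖1 - w‖
  have hρ0 : 0 < ρ := (div_pos ht hpi).trans_le htw
  have hρ2 : ρ ≤ 2 := (norm_sub_le _ _).trans (by rw [norm_one]; linarith)
  have hζ : ‖(1 - w) ^ (β : ℂ)‖ = ρ ^ β := Complex.norm_cpow_real _ _
  have hpow4 : ∀ s : ℝ, 0 ≤ s → s ≤ 1 → Real.pi ^ s ≤ 4 := fun s _ hs1 =>
    (Real.rpow_le_rpow_of_exponent_le (by linarith [Real.pi_gt_three]) hs1).trans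
      (by rw [Real.rpow_one]; exact Real.pi_le_four)
  have hx2 : ρ ^ β ≤ 2 := by
    calc ρ ^ β ≤ 2 ^ β := by gcongr
      _ ≤ 2 ^ (1 : ℝ) := Real.rpow_le_rpow_of_exponent_le one_le_two hβ.2.le
      _ = 2 := Real.rpow_one 2
  have hxt : t ^ β / 4 ≤ ρ ^ β := by
    calc t ^ β / 4 ≤ t ^ β / Real.pi ^ β := by
          gcongr
          exact hpow4 β hβ0.le hβ.2.le
      _ = (t / Real.pi) ^ β := (Real.div_rpow ht.le hpi.le β).symm
      _ ≤ ρ ^ β := by gcongr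
  have hρt : ρ ^ (2 * β - 2) ≤ 4 * t ^ (2 * β - 2) := by
    calc ρ ^ (2 * β - 2) ≤ (t / Real.pi) ^ (2 * β - 2) :=
          Real.rpow_le_rpow_of_nonpos (by positivity) htw (by linarith [hβ.2])
      _ = Real.pi ^ (2 - 2 * β) * t ^ (2 * β - 2) := by
          rw [Real.div_rpow ht.le hpi.le, div_eq_mul_inv, ← Real.rpow_neg hpi.le, mul_comm, neg_sub]
      _ ≤ 4 * t ^ (2 * β - 2) := by
          gcongr
          exact hpow4 _ (by linarith [hβ.2]) (by linarith [hβ.1])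
  have hexp : Real.exp (-(c * n * ρ ^ β)) ≤ Real.exp (-(c / 4 * n) * t ^ β) := by
    rw [Real.exp_le_exp]
    have := mul_le_mul_of_nonneg_left hxt (mul_nonneg hc.le hn0)
    linarith
  rw [← hζ] at h
  constructor
  · refine (norm_pow_sub_pow_succ_sq_le hc h hn).trans ?_
    rw [hζ, Real.rpow_zero, one_mul]
    gcongr
  · have h1 := norm_natCast_mul_pow_sub_sq_le hc hc1 h (hζ.trans_le hx2) hn
    rw [hζ] at h1
    have h2 : (‖w‖ * β) ^ 2 ≤ 1 :=
      pow_le_one₀ (by positivity) (mul_le_one₀ hw.le hβ0.le hβ.2.le)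
    rw [norm_mul, norm_mul, norm_mul, Complex.norm_cpow_real, Complex.norm_real,
      Real.norm_of_nonneg hβ0.le]
    have h3 : (ρ ^ (β - 1)) ^ 2 = ρ ^ (2 * β - 2) := by
      rw [← Real.rpow_mul_natCast hρ0.le]
      congr 1
      push_cast
      ring
    calc _ = ‖(n : ℂ) * (1 - (1 - w) ^ (β : ℂ)) ^ (n - 1) -
        ((n + 1 : ℕ) : ℂ) * (1 - (1 - w) ^ (β : ℂ)) ^ n‖ ^ 2 * (‖w‖ * β) ^ 2 *
          (ρ ^ (β - 1)) ^ 2 := by ring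
      _ ≤ ((Real.exp 2 * (1 + 4 / c)) ^ 2 * Real.exp (-(c / 4 * n) * t ^ β)) * 1 *
          (4 * t ^ (2 * β - 2)) := by
          rw [h3]
          gcongr
          exact h1.trans (by gcongr)
      _ = _ := by ring

lemma hasSum_sub_convPow_A_mul_pow (hβ : β ∈ Set.Ioo (0 : ℝ) 1) (n : ℕ) {w : ℂ} (hw : ‖w‖ ≤ 1) :
    HasSum (fun k => ((convPow (A β) n k - convPow (A β) (n + 1) k : ℝ) : ℂ) * w ^ k)
      ((1 - (1 - w) ^ (β : ℂ)) ^ n - (1 - (1 - w) ^ (β : ℂ)) ^ (n + 1)) := by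
  refine (congrArg (HasSum · _) (funext fun k => ?_)).mp
    ((hasSum_convPow_A_mul_pow hβ n hw).sub (hasSum_convPow_A_mul_pow hβ (n + 1) hw))
  rw [Complex.ofReal_sub, sub_mul]

/-- Parseval on the circle of radius `r < 1`, where the generating function is differentiable; `w`
times the derivative produces the weight `k²`. The bounds are uniform in `r ≥ 1/2`. -/
lemma sum_weighted_sq_le_integral (hβ : β ∈ Set.Ioo (1 / 2 : ℝ) 1) (hc : 0 < c) (hc1 : c ≤ 1)
    (h : ∀ w : ℂ, ‖w‖ ≤ 1 → ‖1 - (1 - w) ^ (β : ℂ)‖ ≤ Real.exp (-(c * ‖1 - w‖ ^ β)))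
    {n : ℕ} (hn : 1 ≤ n) (L : ℝ) (K : ℕ) {r : ℝ} (hr : r ∈ Set.Ico (1 / 2 : ℝ) 1) :
    2 * Real.pi * ∑ k ∈ Finset.range K, (L ^ 2 + (k : ℝ) ^ 2) *
        ((convPow (A β) n k - convPow (A β) (n + 1) k) * r ^ k) ^ 2 ≤
      L ^ 2 * (4 / c ^ 2 * ((n : ℝ) ^ 2)⁻¹ *
          ∫ t : ℝ, |t| ^ (0 : ℝ) * Real.exp (-(c / 4 * n) * |t| ^ β)) +
        4 * (Real.exp 2 * (1 + 4 / c)) ^ 2 *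
          ∫ t : ℝ, |t| ^ (2 * β - 2) * Real.exp (-(c / 4 * n) * |t| ^ β) := by
  have hβ' : β ∈ Set.Ioo (0 : ℝ) 1 := ⟨by linarith [hβ.1], hβ.2⟩
  have hpi := Real.pi_pos
  have hr0 : 0 ≤ r := by linarith [hr.1]
  have hn' : (0 : ℝ) < n := by exact_mod_cast hn
  set d : ℕ → ℝ := fun k => convPow (A β) n k - convPow (A β) (n + 1) k with hd
  have hdsum : Summable fun k => ‖(d k : ℂ)‖ := by
    simp only [Complex.norm_real]
    exact (((isProbability_A hβ').convPow n).2.summable.sub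
      ((isProbability_A hβ').convPow (n + 1)).2.summable).norm
  have hg : ∀ z : ℂ, ‖z‖ < 1 → HasSum (fun k => (d k : ℂ) * z ^ k) _ :=
    fun z hz => hasSum_sub_convPow_A_mul_pow hβ' n hz.le
  have hg' : ∀ z : ℂ, ‖z‖ < 1 → HasSum (fun k : ℕ => ((k : ℂ) * d k) * z ^ k) _ :=
    fun z hz => hasSum_nat_mul_pow_of_hasDerivAt hdsum hg hz (hasDerivAt_pow_sub_pow_succ β n hz)
  have hnorm : ∀ θ : ℝ, ‖(r : ℂ) * Complex.exp (θ * Complex.I)‖ < 1 := by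
    intro θ
    rw [norm_mul, Complex.norm_exp_ofReal_mul_I, Complex.norm_real, Real.norm_of_nonneg hr0,
      mul_one]
    exact hr.2
  have hrC : ‖(r : ℂ)‖ < 1 := by rw [Complex.norm_real, Real.norm_of_nonneg hr0]; exact hr.2
  obtain ⟨hc1', hs1⟩ := hasSum_sq_norm_integral (a := fun k => (d k : ℂ) * (r : ℂ) ^ k)
    (hg r hrC).summable.norm (h := fun θ => _) (fun θ => by
      refine (congrArg (HasSum · _) (funext fun k => ?_)).mp (hg _ (hnorm θ))
      rw [mul_pow, mul_assoc])
  obtain ⟨hc2', hs2⟩ := hasSum_sq_norm_integral (a := fun k => ((k : ℂ) * d k) * (r : ℂ) ^ k)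
    (hg' r hrC).summable.norm (h := fun θ => _) (fun θ => by
      refine (congrArg (HasSum · _) (funext fun k => ?_)).mp (hg' _ (hnorm θ))
      ring)
  have hle := sum_le_hasSum (Finset.range K) (fun k _ => by positivity)
    ((hs1.mul_left (L ^ 2)).add hs2)
  obtain ⟨hi1, -⟩ := integral_abs_rpow_mul_exp (p := β) (q := 0) (b := c / 4 * n) hβ'.1
    (by norm_num) (by positivity)
  obtain ⟨hi2, -⟩ := integral_abs_rpow_mul_exp (p := β) (q := 2 * β - 2) (b := c / 4 * n) hβ'.1
    (by linarith [hβ.1]) (by positivity)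
  -- The null point `θ = 0` is excluded: there the majorant with the negative power `|θ|^(2β-2)`
  -- takes the default value 0.
  have hmono : ∀ (f : ℝ → ℝ) (H : ℝ → ℝ), Continuous f → Integrable H → (∀ t, 0 ≤ H t) →
      (∀ θ : ℝ, |θ| ≤ Real.pi → θ ≠ 0 → f θ ≤ H θ) →
      ∫ θ in (-Real.pi)..Real.pi, f θ ≤ ∫ t, H t := by
    intro f H hf hH hH0 hfH
    rw [intervalIntegral.integral_of_le (by linarith)]
    refine le_trans (setIntegral_mono_on_ae (hf.integrableOn_Ioc) hH.integrableOn
      measurableSet_Ioc ?_) (setIntegral_le_integral hH (Eventually.of_forall hH0))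
    filter_upwards [Measure.ae_ne volume (0 : ℝ)] with θ hθ hθ'
    exact hfH θ (abs_le.mpr ⟨hθ'.1.le, hθ'.2⟩) hθ
  have hm1 := hmono _ _ (hc1'.norm.pow 2) (hi1.const_mul (4 / c ^ 2 * ((n : ℝ) ^ 2)⁻¹))
    (fun t => by positivity) (fun θ hθ hθ0 =>
      (norm_sq_bounds hβ hc hc1 (hnorm θ) (h _ (hnorm θ).le) hn (abs_pos.mpr hθ0)
        (abs_div_pi_le_norm_one_sub hr.1 hθ)).1)
  have hm2 := hmono _ _ (hc2'.norm.pow 2) (hi2.const_mul (4 * (Real.exp 2 * (1 + 4 / c)) ^ 2))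
    (fun t => by positivity) (fun θ hθ hθ0 =>
      (norm_sq_bounds hβ hc hc1 (hnorm θ) (h _ (hnorm θ).le) hn (abs_pos.mpr hθ0)
        (abs_div_pi_le_norm_one_sub hr.1 hθ)).2)
  rw [integral_const_mul] at hm1 hm2
  calc _ = ∑ k ∈ Finset.range K, (L ^ 2 * (2 * Real.pi * ‖(d k : ℂ) * (r : ℂ) ^ k‖ ^ 2) +
        2 * Real.pi * ‖((k : ℂ) * d k) * (r : ℂ) ^ k‖ ^ 2) := by
        rw [Finset.mul_sum]
        refine Finset.sum_congr rfl fun k _ => ?_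
        simp only [norm_mul, norm_pow, Complex.norm_real, Complex.norm_natCast, Real.norm_eq_abs,
          mul_pow, sq_abs, pow_right_comm _ k 2, hd]
        ring
    _ ≤ _ := hle
    _ ≤ _ := by
        refine add_le_add (mul_le_mul_of_nonneg_left hm1 (sq_nonneg L)) hm2

lemma exists_sum_weighted_sq_le (hβ : β ∈ Set.Ioo (1 / 2 : ℝ) 1) :
    ∃ D : ℝ, 0 ≤ D ∧ ∀ n : ℕ, 1 ≤ n → ∀ K : ℕ,
      ∑ k ∈ Finset.range K, (((n : ℝ) ^ (1 / β)) ^ 2 + (k : ℝ) ^ 2) *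
        (convPow (A β) n k - convPow (A β) (n + 1) k) ^ 2 ≤ D * (n : ℝ) ^ (1 / β - 2) := by
  obtain ⟨c, hc, hc1, h⟩ := norm_one_sub_cpow_le_exp hβ
  have hβ0 : 0 < β := by linarith [hβ.1]
  have hG1 := Real.Gamma_pos_of_pos (show 0 < (0 + 1) / β by positivity)
  have hG2 := Real.Gamma_pos_of_pos (show 0 < (2 * β - 2 + 1) / β from
    div_pos (by linarith [hβ.1]) hβ0)
  set D₁ := 4 / c ^ 2 * (2 / β * Real.Gamma ((0 + 1) / β) * (c / 4) ^ (-(0 + 1) / β))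
  set D₂ := 4 * (Real.exp 2 * (1 + 4 / c)) ^ 2 *
    (2 / β * Real.Gamma ((2 * β - 2 + 1) / β) * (c / 4) ^ (-(2 * β - 2 + 1) / β))
  have hD₁ : 0 ≤ D₁ := by positivity
  have hD₂ : 0 ≤ D₂ := by positivity
  refine ⟨(2 * Real.pi)⁻¹ * (D₁ + D₂), by positivity, fun n hn K => ?_⟩
  have hn' : (0 : ℝ) < n := by exact_mod_cast hn
  have hr : ∀ r ∈ Set.Ico (1 / 2 : ℝ) 1, ∑ k ∈ Finset.range K,
      (((n : ℝ) ^ (1 / β)) ^ 2 + (k : ℝ) ^ 2) *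
        ((convPow (A β) n k - convPow (A β) (n + 1) k) * r ^ k) ^ 2 ≤
      (2 * Real.pi)⁻¹ * (D₁ + D₂) * (n : ℝ) ^ (1 / β - 2) := by
    intro r hr
    have h1 := sum_weighted_sq_le_integral hβ hc hc1 h hn ((n : ℝ) ^ (1 / β)) K hr
    rw [(integral_abs_rpow_mul_exp hβ0 (by norm_num) (by positivity)).2,
      (integral_abs_rpow_mul_exp hβ0 (by linarith [hβ.1]) (by positivity)).2,
      Real.mul_rpow (by positivity) hn'.le, Real.mul_rpow (by positivity) hn'.le] at h1
    -- With `L = n^(1/β)` both integrals scale alike: `2/β - 2 - 1/β = 1/β - 2`, and `e2` gives the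
    -- same exponent for the derivative.
    have e1 : ((n : ℝ) ^ (1 / β)) ^ 2 * ((n : ℝ) ^ 2)⁻¹ * (n : ℝ) ^ (-(0 + 1) / β) =
        (n : ℝ) ^ (1 / β - 2) := by
      rw [← Real.rpow_mul_natCast hn'.le, ← Real.rpow_natCast (n : ℝ) 2, ← Real.rpow_neg hn'.le,
        ← Real.rpow_add hn', ← Real.rpow_add hn']
      congr 1
      push_cast
      field_simp
      ring
    have e2 : -(2 * β - 2 + 1) / β = 1 / β - 2 := by
      field_simp
      ring
    have h2 : 2 * Real.pi * ∑ k ∈ Finset.range K,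
        (((n : ℝ) ^ (1 / β)) ^ 2 + (k : ℝ) ^ 2) *
        ((convPow (A β) n k - convPow (A β) (n + 1) k) * r ^ k) ^ 2 ≤
        (D₁ + D₂) * (n : ℝ) ^ (1 / β - 2) := by
      refine h1.trans (le_of_eq ?_)
      rw [add_mul]
      congr 1
      · rw [← e1]; ring
      · rw [← e2]; ring
    rw [mul_assoc, ← div_eq_inv_mul, le_div_iff₀ (by positivity), mul_comm]
    exact h2
  -- The sum is finite, so `r → 1` is harmless.
  have hlim : Tendsto (fun r : ℝ => ∑ k ∈ Finset.range K,
      (((n : ℝ) ^ (1 / β)) ^ 2 + (k : ℝ) ^ 2) *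
        ((convPow (A β) n k - convPow (A β) (n + 1) k) * r ^ k) ^ 2) (𝓝[<] 1)
      (𝓝 (∑ k ∈ Finset.range K, (((n : ℝ) ^ (1 / β)) ^ 2 + (k : ℝ) ^ 2) *
        ((convPow (A β) n k - convPow (A β) (n + 1) k) * 1 ^ k) ^ 2)) :=
    (Continuous.tendsto (by fun_prop) 1).mono_left nhdsWithin_le_nhds
  simp only [one_pow, mul_one] at hlim
  refine le_of_tendsto hlim ?_
  filter_upwards [Ico_mem_nhdsLT (show (1 / 2 : ℝ) < 1 by norm_num)] with r hr'
  exact hr r hr'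

end WeightedEstimate

/-! ### Membership in `classA`. -/

lemma A_mem_classA_of_half_lt {β : ℝ} (hβ : β ∈ Set.Ioo (1 / 2 : ℝ) 1) : A β ∈ classA := by
  have hβ' : β ∈ Set.Ioo (0 : ℝ) 1 := ⟨by linarith [hβ.1], hβ.2⟩
  obtain ⟨D, hD, h⟩ := exists_sum_weighted_sq_le hβ
  refine ⟨isProbability_A hβ', 2 * √D, fun n hn => ?_⟩
  have hn' : (0 : ℝ) < n := by exact_mod_cast hn
  have hs : Summable fun k => |convPow (A β) n k - convPow (A β) (n + 1) k| :=
    (((isProbability_A hβ').convPow n).2.summable.sub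
      ((isProbability_A hβ').convPow (n + 1)).2.summable).abs
  refine ⟨hs, ?_⟩
  rw [← le_div_iff₀' hn']
  refine Real.tsum_le_of_sum_range_le (fun k => abs_nonneg _) fun K => ?_
  have hL : 1 ≤ (n : ℝ) ^ (1 / β) :=
    Real.one_le_rpow (by exact_mod_cast hn) (one_div_nonneg.mpr hβ'.1.le)
  have h1 := sum_abs_sq_le hL K (h n hn K)
  -- The powers cancel: `(4 / n^(1/β)) D n^(1/β - 2) = (2√D / n)²`.
  refine (abs_le_of_sq_le_sq' (h1.trans (le_of_eq ?_)) (by positivity)).2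
  rw [Real.rpow_sub hn', Real.rpow_two, div_pow, mul_pow, Real.sq_sqrt hD]
  have : (n : ℝ) ^ (1 / β) ≠ 0 := by positivity
  field_simp
  ring

lemma A_mem_classA {α : ℝ} (hα : α ∈ Set.Ioo (0 : ℝ) 1) : A α ∈ classA := by
  -- Any `β` with `max α (1/2) < β < 1` works, with `γ = α / β`.
  obtain ⟨β, hβ1, hβ2⟩ := exists_between (max_lt hα.2 (show (1 / 2 : ℝ) < 1 by norm_num))
  obtain ⟨hαβ, hβ⟩ := max_lt_iff.mp hβ1
  have hβ0 : 0 < β := hα.1.trans hαβ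
  have h := A_mul_mem_classA (β := β) (γ := α / β) ⟨hβ0, hβ2⟩
    ⟨div_pos hα.1 hβ0, (div_lt_one hβ0).mpr hαβ⟩ (A_mem_classA_of_half_lt ⟨hβ, hβ2⟩)
  rwa [mul_div_cancel₀ α hβ0.ne'] at h

end RittSubordination

theorem theorem1p1 (α : ℝ) (hα : α ∈ Set.Ioo (0 : ℝ) 1) :
    RittSubordination.IsProbability (RittSubordination.A α) ∧
    (∀ w : ℂ, ‖w‖ ≤ 1 →
      HasSum (fun k : ℕ => (RittSubordination.A α k : ℂ) * w ^ k) (1 - (1 - w) ^ (α : ℂ))) ∧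
    RittSubordination.A α ∈ RittSubordination.classA ∧
    ∀ (X : Type*) [NormedAddCommGroup X] [NormedSpace ℂ X] [CompleteSpace X]
      (T : X →L[ℂ] X), RittSubordination.IsPowerBounded T →
      Summable (fun k : ℕ => ‖(RittSubordination.A α k : ℂ) • T ^ k‖) ∧
      RittSubordination.IsNonnegativeOperator (1 - T) ∧
      MeasureTheory.IntegrableOn (RittSubordination.balakrishnanIntegrand (1 - T) α)
        (Set.Ioi (0 : ℝ)) MeasureTheory.volume ∧
      RittSubordination.Psi (RittSubordination.A α) T
        = 1 - RittSubordination.fracPow (1 - T) α ∧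
      RittSubordination.IsRitt (RittSubordination.Psi (RittSubordination.A α) T) := by
  refine ⟨RittSubordination.isProbability_A hα, fun w hw => RittSubordination.hasSum_A_mul_pow hα hw,
    RittSubordination.A_mem_classA hα, fun X _ _ _ T hT => ?_⟩
  obtain ⟨M, hM⟩ := hT.exists_forall_norm_pow_le
  have hV := RittSubordination.isNonnegativeOperator_one_sub hT
  exact ⟨RittSubordination.summable_norm_smul_pow hM (RittSubordination.summable_A hα), hV,
    RittSubordination.integrableOn_balakrishnanIntegrand hV hα, RittSubordination.Psi_A_eq hα hT,
    RittSubordination.isRitt_Psi (RittSubordination.A_mem_classA hα) hT⟩
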